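/- Let $n\ge 2$. For a measurable set $\Omega\subset\mathbb{R}^{n-1}$, $f\in L^1(\Omega)$ and $x=(x',x^*)\in\mathbb{R}^{n-1}\times\mathbb{R}$ put $$\mathcal{E}_\Omega f(x)=\int_\Omega f(\xi)\,e^{2\pi i(x'\cdot\xi+x^*|\xi|^2)}\,d\xi .$$ For $1\le p,q\le\infty$ and $0<D\le 1$ let $\mathrm{BR}^*_{\mathbb{P}^{n-1}}(q\times q\mapsto p,D)\in[0,\infty]$ be the least constant $C$ such that $$\big\||\mathcal{E}_{\Omega_1}f\,\mathcal{E}_{\Omega_2}f|^{1/2}\big\|_{L^p(\mathbb{R}^n)}\le C\big(\|f\|_{L^q(\Omega_1)}\|f\|_{L^q(\Omega_2)}\big)^{1/2}$$ for all closed axis-parallel cubes $\Omega_1,\Omega_2\subset[-1,1]^{n-1}$ (of possibly different side lengths) with $\inf\{|\xi_1-\xi_2|:\xi_1\in\Omega_1,\ \xi_2\in\Omega_2\}\ge D$ and all $f\in L^q(\Omega_1\cup\Omega_2)$. We say that $\mathcal{R}^*_{\mathbb{P}^{n-1}}(q\mapsto p)$ holds if there is a finite constant $C$ with $$\|\mathcal{E}_{U}f\|_{L^p(\mathbb{R}^n)}\le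 C\|f\|_{L^q(U)}\quad\text{for all } f\in L^q(U),\qquad U=(-1,1)^{n-1}.$$ (a) Suppose that either $n\ge 3$ and $\frac{2n}{n-1}<p\le 4$, or $n=2$ and $4<p\le\infty$. If $\mathrm{BR}^*_{\mathbb{P}^{n-1}}(\infty\times\infty\mapsto p,\tfrac12)<\infty$, then $\mathcal{R}^*_{\mathbb{P}^{n-1}}(\infty\mapsto p)$ holds. (b) For $n=2$ the full linear restriction range is obtained: for $1\le p\le\infty$, $\mathcal{R}^*_{\mathbb{P}^{1}}(\infty\mapsto p)$ holds if and only if $p>4$. -/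

import Mathlib

open MeasureTheory
open scoped ENNReal NNReal

noncomputable section

namespace Restriction

/-- The frequency space `ℝ^{n-1}`, with the Euclidean norm and Lebesgue measure. -/
abbrev Freq (n : ℕ) : Type := EuclideanSpace ℝ (Fin (n - 1))

/-- The physical space `ℝ^n = ℝ^{n-1} × ℝ`, points written `x = (x', x*)`, with Lebesgue measure. -/
abbrev Phys (n : ℕ) : Type := Freq n × ℝ

/-- The extension operator of the paraboloid over `Ω ⊆ ℝ^{n-1}`:
`E_Ω f (x', x*) = ∫_Ω f(ξ) e^{2πi (x' · ξ + x* |ξ|²)} dξ`. -/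
def extOp {n : ℕ} (Ω : Set (Freq n)) (f : Freq n → ℂ) (x : Phys n) : ℂ :=
  ∫ ξ in Ω, f ξ *
    Complex.exp (2 * Real.pi * Complex.I * ((inner ℝ x.1 ξ + x.2 * ‖ξ‖ ^ 2 : ℝ) : ℂ))

/-- The closed axis-parallel cube with centre `c` and side length `2 * r`. -/
def closedCube {n : ℕ} (c : Freq n) (r : ℝ) : Set (Freq n) :=
  {ξ | ∀ j, |ξ j - c j| ≤ r}

/-- `Ω` is a (closed, axis-parallel, nondegenerate) cube in `ℝ^{n-1}`. -/
def IsCube {n : ℕ} (Ω : Set (Freq n)) : Prop :=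
  ∃ (c : Freq n) (r : ℝ), 0 < r ∧ Ω = closedCube c r

/-- The open cube `(-1,1)^{n-1}` over which the truncated paraboloid `P^{n-1}` is a graph. -/
def openUnitCube (n : ℕ) : Set (Freq n) :=
  {ξ | ∀ j, |ξ j| < 1}

/-- `d(A, B) = inf {|x - y| : x ∈ A, y ∈ B}`. -/
def setDist {n : ℕ} (A B : Set (Freq n)) : ℝ≥0∞ :=
  ⨅ x ∈ A, ⨅ y ∈ B, edist x y

/-- `C` is admissible in the bilinear extension inequality `q × q → p` for all pairs of cubes in
`[-1,1]^{n-1}` at distance at least `D`. -/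
def BilinearBound (n : ℕ) (q p : ℝ≥0∞) (D : ℝ) (C : ℝ≥0∞) : Prop :=
  ∀ Ω₁ Ω₂ : Set (Freq n), IsCube Ω₁ → IsCube Ω₂ →
    Ω₁ ⊆ closedCube 0 1 → Ω₂ ⊆ closedCube 0 1 → ENNReal.ofReal D ≤ setDist Ω₁ Ω₂ →
    ∀ f : Freq n → ℂ, MemLp f q (volume.restrict (Ω₁ ∪ Ω₂)) →
      eLpNorm (fun x : Phys n => ‖extOp Ω₁ f x * extOp Ω₂ f x‖ ^ (1 / 2 : ℝ)) p volume ≤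
        C * (eLpNorm f q (volume.restrict Ω₁) * eLpNorm f q (volume.restrict Ω₂)) ^ (1 / 2 : ℝ)

/-- The bilinear restriction constant `BR*_{P^{n-1}}(q × q → p, D)`: the least constant in the
bilinear extension inequality (`∞` if there is no finite one). -/
def BR (n : ℕ) (q p : ℝ≥0∞) (D : ℝ) : ℝ≥0∞ :=
  sInf {C | BilinearBound n q p D C}

/-- The linear extension estimate `R*_{P^{n-1}}(q → p)`:
`‖E f‖_{L^p(ℝ^n)} ≤ C ‖f‖_{L^q}` for all `f ∈ L^q((-1,1)^{n-1})`, with `C` finite and independent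
of `f`. -/
def LinearExtension (n : ℕ) (q p : ℝ≥0∞) : Prop :=
  ∃ C : ℝ≥0, ∀ f : Freq n → ℂ, MemLp f q (volume.restrict (openUnitCube n)) →
    eLpNorm (extOp (openUnitCube n) f) p volume ≤
      C * eLpNorm f q (volume.restrict (openUnitCube n))

end Restriction

end

namespace Restriction

/-! The passage from bilinear to linear is short because the data lie in `L^∞`: a function bounded
by one, cut into pieces and rescaled, yields functions bounded by one. Put `d = n - 1` and let `A`
be the supremum of `∫_{B_R} |E f|^P` over such `f` on `[-1,1]^d`; it is finite by the trivial bound.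
Tile the cube by `K^d` subcubes. At each point `|E f|` is at most `3^d` times the largest piece plus
the geometric means of pieces from non-neighbouring tiles (`enorm_sum_le_broad_narrow`). Parabolic
rescaling bounds the contribution of one tile by `K^(-dP+d+2) A`, hence the first part by a constant
times `K^(-(dP-2(d+1))) A`, a negative power of `K` exactly when `P > 2n/(n-1)`. Non-neighbouring
pairs rescale to the bilinear hypothesis (`UnitBilinearBound.rescale`). A large fixed `K` gives `A ≤
A/2 + D` with `D` independent of `R` (`exists_local_bound_of_bilinear`), and `R` tends to infinity.

In the plane the bilinear estimate at `p = 4` can be proved outright. The product of two extensions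
is the Fourier transform of a density transported by `(ξ, η) ↦ (ξ + η, ξ² + η²)`, whose Jacobian
`2(η - ξ)` stays away from zero on separated intervals. Gaussian weights take the place of
Plancherel and of the change of variables (`integral_gaussian_mul_norm_sq_le`,
`sq_add_sq_le_of_separated`). Boundedness of the extensions gives larger `p`, and the reduction then
gives the linear estimate for finite `p > 4`; `p = ∞` is trivial.

Conversely, the extension of the constant `1` has size at least `c/√t` for `|y| ≤ t` and `t ≥ 4`, so
its `p`-th power has infinite integral when `p ≤ 4`. -/

/-! ### Elementary bounds for the extension operator. -/

lemma norm_cexp_two_pi_I_mul (r : ℝ) :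
    ‖Complex.exp (2 * Real.pi * Complex.I * (r : ℂ))‖ = 1 := by
  have : (2 * Real.pi * Complex.I * (r : ℂ)) = ((2 * Real.pi * r : ℝ) : ℂ) * Complex.I := by
    push_cast; ring
  rw [this, Complex.norm_exp_ofReal_mul_I]

/-- The extension operator is bounded from `L^1` to `L^∞`. -/
lemma enorm_extOp_le {n : ℕ} (Ω : Set (Freq n)) (f : Freq n → ℂ) (x : Phys n) :
    ‖extOp Ω f x‖ₑ ≤ ∫⁻ ξ in Ω, ‖f ξ‖ₑ := by
  refine (enorm_integral_le_lintegral_enorm _).trans (le_of_eq ?_)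
  congr 1 with ξ
  rw [enorm_mul, ← ofReal_norm (Complex.exp _), norm_cexp_two_pi_I_mul]
  simp

/-- Measurable functions bounded by one. -/
def UnitBounded {n : ℕ} (f : Freq n → ℂ) : Prop :=
  Measurable f ∧ ∀ ξ, ‖f ξ‖ ≤ 1

lemma UnitBounded.enorm_extOp_le {n : ℕ} {f : Freq n → ℂ} (hf : UnitBounded f)
    (Ω : Set (Freq n)) (x : Phys n) : ‖extOp Ω f x‖ₑ ≤ volume Ω := by
  refine (Restriction.enorm_extOp_le Ω f x).trans ?_
  calc ∫⁻ ξ in Ω, ‖f ξ‖ₑ ≤ ∫⁻ _ in Ω, 1 := by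
        refine lintegral_mono fun ξ => ?_
        rw [← ofReal_norm]
        exact ENNReal.ofReal_le_one.2 (hf.2 ξ)
    _ = volume Ω := by simp

lemma UnitBounded.comp {n : ℕ} {f : Freq n → ℂ} (hf : UnitBounded f) {g : Freq n → Freq n}
    (hg : Measurable g) : UnitBounded (fun ξ => f (g ξ)) :=
  ⟨hf.1.comp hg, fun ξ => hf.2 (g ξ)⟩

lemma UnitBounded.indicator {n : ℕ} {f : Freq n → ℂ} (hf : UnitBounded f) {s : Set (Freq n)}
    (hs : MeasurableSet s) : UnitBounded (s.indicator f) :=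
  ⟨hf.1.indicator hs, fun ξ => (norm_indicator_le_norm_self f ξ).trans (hf.2 ξ)⟩

lemma UnitBounded.continuous_extOp {n : ℕ} {f : Freq n → ℂ} (hf : UnitBounded f)
    {Ω : Set (Freq n)} (hΩ : volume Ω ≠ ∞) : Continuous (extOp Ω f) := by
  unfold extOp
  have : IsFiniteMeasure (volume.restrict Ω) := ⟨by simpa using hΩ.lt_top⟩
  refine continuous_of_dominated (bound := fun _ => 1) ?_ ?_ (integrable_const _) ?_
  · intro x
    have h1 := hf.1
    refine Measurable.aestronglyMeasurable ?_
    fun_prop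
  · intro x
    refine Filter.Eventually.of_forall fun ξ => ?_
    rw [norm_mul, norm_cexp_two_pi_I_mul, mul_one]
    exact hf.2 ξ
  · refine Filter.Eventually.of_forall fun ξ => ?_
    fun_prop

lemma isClosed_closedCube {n : ℕ} (c : Freq n) (r : ℝ) : IsClosed (closedCube c r) := by
  have : closedCube c r = ⋂ j, {ξ : Freq n | |ξ j - c j| ≤ r} := by
    ext; simp [closedCube]
  rw [this]
  exact isClosed_iInter fun j => isClosed_le (by fun_prop) continuous_const

lemma measurableSet_closedCube {n : ℕ} (c : Freq n) (r : ℝ) : MeasurableSet (closedCube c r) :=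
  (isClosed_closedCube c r).measurableSet

lemma norm_le_of_mem_closedCube {n : ℕ} {ξ : Freq n} (h : ξ ∈ closedCube 0 1) : ‖ξ‖ ≤ n := by
  have h1 : ‖ξ‖ ^ 2 ≤ (n : ℝ) ^ 2 := by
    rw [EuclideanSpace.norm_sq_eq]
    calc ∑ i, ‖ξ i‖ ^ 2 ≤ ∑ _i : Fin (n - 1), (1 : ℝ) := by
          refine Finset.sum_le_sum fun i _ => ?_
          have := h i
          simp only [PiLp.zero_apply, sub_zero] at this
          rw [Real.norm_eq_abs]
          exact pow_le_one₀ (abs_nonneg _) this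
      _ = ((n - 1 : ℕ) : ℝ) := by simp
      _ ≤ (n : ℝ) := by exact_mod_cast Nat.sub_le n 1
      _ ≤ (n : ℝ) ^ 2 := by
          rcases Nat.eq_zero_or_pos n with rfl | hn
          · simp
          · have : (1 : ℝ) ≤ n := by exact_mod_cast hn
            nlinarith
  exact (pow_le_pow_iff_left₀ (norm_nonneg _) (Nat.cast_nonneg _) two_ne_zero).1 h1

lemma volume_ne_top_of_subset_closedCube {n : ℕ} {Ω : Set (Freq n)}
    (h : Ω ⊆ closedCube 0 1) : volume Ω ≠ ∞ := by
  refine ne_top_of_le_ne_top (measure_closedBall_lt_top (x := (0 : Freq n)) (r := n)).ne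
    (measure_mono fun ξ hξ => ?_)
  simpa using norm_le_of_mem_closedCube (h hξ)

/-! ### Parabolic rescaling. -/

/-- The parabolic rescaling of physical space that corresponds to the affine map
`η ↦ c + σ η` of frequency space. -/
def parabolicMap {n : ℕ} (c : Freq n) (σ : ℝ) (x : Phys n) : Phys n :=
  (σ • (x.1 + (2 * x.2) • c), σ ^ 2 * x.2)

/-- Substituting `ξ = c + σ η` turns the phase into `x'·c + x*|c|²`, which is constant in `η` and
drops out of the norm, plus `σ(x' + 2x* c)·η + σ² x*|η|²`, the phase at `parabolicMap c σ x`. -/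
lemma enorm_extOp_rescale {n : ℕ} {Ω : Set (Freq n)} (hΩ : MeasurableSet Ω) (f : Freq n → ℂ)
    (c : Freq n) {σ : ℝ} (hσ : 0 < σ) (x : Phys n) :
    ‖extOp Ω f x‖ₑ = ENNReal.ofReal (σ ^ (n - 1)) *
      ‖extOp ((fun η : Freq n => c + σ • η) ⁻¹' Ω) (fun η => f (c + σ • η))
        (parabolicMap c σ x)‖ₑ := by
  set F : Freq n → ℂ := fun ξ => Ω.indicator (fun ξ => f ξ *
    Complex.exp (2 * Real.pi * Complex.I * ((inner ℝ x.1 ξ + x.2 * ‖ξ‖ ^ 2 : ℝ) : ℂ))) ξ with hF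
  have hpre : MeasurableSet ((fun η : Freq n => c + σ • η) ⁻¹' Ω) := by
    apply hΩ.preimage; fun_prop
  have h1 : extOp Ω f x = ∫ ξ, F ξ := (integral_indicator hΩ).symm
  have h2 : ∫ η, F (c + σ • η) = (σ ^ (n - 1))⁻¹ • ∫ ξ, F ξ := by
    have := Measure.integral_comp_smul_of_nonneg (volume : Measure (Freq n))
      (fun ξ => F (c + ξ)) σ (hR := hσ.le)
    rw [this, integral_add_left_eq_self F c]
    simp
  have h3 : ∫ η, F (c + σ • η) = Complex.exp (2 * Real.pi * Complex.I *
        ((inner ℝ x.1 c + x.2 * ‖c‖ ^ 2 : ℝ) : ℂ)) *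
      extOp ((fun η : Freq n => c + σ • η) ⁻¹' Ω) (fun η => f (c + σ • η))
        (parabolicMap c σ x) := by
    unfold extOp
    rw [← integral_const_mul, ← integral_indicator hpre]
    congr 1 with η
    simp only [hF, Set.indicator]
    by_cases h : c + σ • η ∈ Ω
    · have h' : η ∈ (fun η : Freq n => c + σ • η) ⁻¹' Ω := h
      rw [if_pos h, if_pos h', mul_left_comm, ← Complex.exp_add]
      congr 2
      rw [← mul_add, ← Complex.ofReal_add]
      congr 2
      simp only [parabolicMap, inner_add_right, inner_smul_right, inner_smul_left,
        inner_add_left, norm_add_sq_real, norm_smul, Real.norm_eq_abs, mul_pow, sq_abs]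
      simp
      ring
    · have h' : ¬ η ∈ (fun η : Freq n => c + σ • η) ⁻¹' Ω := h
      rw [if_neg h, if_neg h']
  have h4 : extOp Ω f x = (σ ^ (n - 1) : ℝ) • ∫ η, F (c + σ • η) := by
    rw [h2, smul_smul, mul_inv_cancel₀ (by positivity), one_smul, h1]
  rw [h4, enorm_smul, h3, enorm_mul, ← ofReal_norm (Complex.exp _), norm_cexp_two_pi_I_mul,
    Real.enorm_of_nonneg (by positivity)]
  simp

lemma lintegral_comp_smul_of_pos {E : Type*} [NormedAddCommGroup E] [NormedSpace ℝ E]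
    [MeasurableSpace E] [BorelSpace E] [FiniteDimensional ℝ E] (μ : Measure E)
    [μ.IsAddHaarMeasure] (g : E → ℝ≥0∞) {σ : ℝ} (hσ : 0 < σ) :
    ∫⁻ x, g (σ • x) ∂μ = ENNReal.ofReal ((σ ^ Module.finrank ℝ E)⁻¹) * ∫⁻ x, g x ∂μ := by
  have he : MeasurableEmbedding (fun x : E => σ • x) :=
    (Homeomorph.smulOfNeZero σ hσ.ne').measurableEmbedding
  have := he.lintegral_map (μ := μ) g
  rw [← this, Measure.map_addHaar_smul μ hσ.ne', lintegral_smul_measure,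
    abs_of_pos (by positivity), smul_eq_mul]

/-- At fixed time the map is a translation followed by a dilation by `σ`, and time is dilated by
`σ²`; the shear by `c` does not change the Jacobian `σ^(n-1+2)`. -/
lemma lintegral_comp_parabolicMap {n : ℕ} (c : Freq n) {σ : ℝ} (hσ : 0 < σ)
    {g : Phys n → ℝ≥0∞} (hg : Measurable g) :
    ∫⁻ x, g (parabolicMap c σ x) = ENNReal.ofReal ((σ ^ (n - 1 + 2))⁻¹) * ∫⁻ x, g x := by
  have hm : Measurable (parabolicMap c σ) := by unfold parabolicMap; fun_prop
  have e1 : ∀ t : ℝ, ∫⁻ y : Freq n, g (parabolicMap c σ (y, t)) =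
      ENNReal.ofReal ((σ ^ (n - 1))⁻¹) * ∫⁻ y : Freq n, g (y, σ ^ 2 * t) := by
    intro t
    have h1 := lintegral_add_right_eq_self (μ := (volume : Measure (Freq n)))
      (fun y : Freq n => g (σ • y, σ ^ 2 * t)) ((2 * t) • c)
    have h2 := lintegral_comp_smul_of_pos (volume : Measure (Freq n))
      (fun y : Freq n => g (y, σ ^ 2 * t)) hσ
    simp only [finrank_euclideanSpace, Fintype.card_fin] at h2
    rw [← h2, ← h1]
    rfl
  have e2 := lintegral_comp_smul_of_pos (volume : Measure ℝ)
      (fun t : ℝ => ∫⁻ y : Freq n, g (y, t)) (pow_pos hσ 2)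
  simp only [Module.finrank_self, pow_one, smul_eq_mul] at e2
  have hs : Measurable fun t : ℝ => ∫⁻ y : Freq n, g (y, σ ^ 2 * t) := by
    have : Measurable fun z : Phys n => g (z.1, σ ^ 2 * z.2) := by fun_prop
    exact this.lintegral_prod_left'
  rw [Measure.volume_eq_prod, lintegral_prod_symm' (fun x => g (parabolicMap c σ x)) (hg.comp hm),
    lintegral_prod_symm' _ hg]
  simp only [e1]
  rw [lintegral_const_mul _ hs, e2, ← mul_assoc, ← ENNReal.ofReal_mul (by positivity)]
  congr 2
  rw [pow_add, mul_inv]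

lemma preimage_closedCube {n : ℕ} (c c₀ : Freq n) (r : ℝ) {σ : ℝ} (hσ : 0 < σ) :
    (fun η : Freq n => c₀ + σ • η) ⁻¹' closedCube c r =
      closedCube (σ⁻¹ • (c - c₀)) (r / σ) := by
  ext η
  simp only [closedCube, Set.mem_preimage, Set.mem_ofPred_eq, PiLp.add_apply, PiLp.smul_apply,
    PiLp.sub_apply, smul_eq_mul]
  refine forall_congr' fun j => ?_
  rw [le_div_iff₀ hσ, ← abs_of_pos hσ, ← abs_mul, abs_of_pos hσ]
  have : (η j - σ⁻¹ * (c j - c₀ j)) * σ = c₀ j + σ * η j - c j := by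
    field_simp; ring
  rw [this]

/-- For small `σ` rescaling does not leave the ball, so the localized estimate can be applied to
itself with the same `R`. -/
lemma parabolicMap_mem_closedBall {n : ℕ} {c : Freq n} {σ R : ℝ} (hσ : 0 < σ)
    (h : σ * (1 + 2 * ‖c‖) ≤ 1) {x : Phys n} (hx : x ∈ Metric.closedBall 0 R) :
    parabolicMap c σ x ∈ Metric.closedBall 0 R := by
  have hx' : ‖x.1‖ ≤ R ∧ ‖x.2‖ ≤ R := by
    simpa [Prod.norm_def] using hx
  have hR : 0 ≤ R := (norm_nonneg _).trans hx'.1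
  have hσ1 : σ ≤ 1 := by nlinarith [norm_nonneg c, mul_nonneg hσ.le (norm_nonneg c)]
  rw [mem_closedBall_zero_iff, Prod.norm_def, max_le_iff]
  constructor
  · calc ‖(parabolicMap c σ x).1‖ = σ * ‖x.1 + (2 * x.2) • c‖ := by
          rw [parabolicMap, norm_smul, Real.norm_of_nonneg hσ.le]
      _ ≤ σ * (R + 2 * R * ‖c‖) := by
          gcongr
          refine (norm_add_le _ _).trans ?_
          rw [norm_smul, norm_mul, Real.norm_ofNat]
          gcongr
          · exact hx'.1
          · exact hx'.2
      _ = (σ * (1 + 2 * ‖c‖)) * R := by ring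
      _ ≤ 1 * R := by gcongr
      _ = R := one_mul R
  · calc ‖(parabolicMap c σ x).2‖ = σ ^ 2 * ‖x.2‖ := by
          simp [parabolicMap]
      _ ≤ 1 * R := by
          gcongr
          · exact pow_le_one₀ hσ.le hσ1
          · exact hx'.2
      _ = R := one_mul R

lemma measurable_enorm_extOp_rpow {n : ℕ} {f : Freq n → ℂ} (hf : UnitBounded f)
    {Ω : Set (Freq n)} (hΩ : volume Ω ≠ ∞) (P : ℝ) :
    Measurable fun x : Phys n => ‖extOp Ω f x‖ₑ ^ P :=
  ((hf.continuous_extOp hΩ).measurable.enorm).pow_const P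

lemma UnitBounded.affine {n : ℕ} {f : Freq n → ℂ} (hf : UnitBounded f) (c : Freq n) (σ : ℝ) :
    UnitBounded (fun η => f (c + σ • η)) :=
  hf.comp (by fun_prop)

/-- Parabolic rescaling of the localized linear estimate on a small cube. -/
lemma lintegral_extOp_small_cube_le {n : ℕ} {c : Freq n} {σ R P : ℝ} (hσ : 0 < σ) (hP : 0 ≤ P)
    (h : σ * (1 + 2 * ‖c‖) ≤ 1) {f : Freq n → ℂ} (hf : UnitBounded f) :
    ∫⁻ x in Metric.closedBall (0 : Phys n) R, ‖extOp (closedCube c σ) f x‖ₑ ^ P ≤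
      ENNReal.ofReal (σ ^ (n - 1)) ^ P * ENNReal.ofReal ((σ ^ (n - 1 + 2))⁻¹) *
      ∫⁻ x in Metric.closedBall (0 : Phys n) R,
        ‖extOp (closedCube 0 1) (fun η => f (c + σ • η)) x‖ₑ ^ P := by
  have hB : MeasurableSet (Metric.closedBall (0 : Phys n) R) :=
    Metric.isClosed_closedBall.measurableSet
  set G : Phys n → ℝ≥0∞ := (Metric.closedBall (0 : Phys n) R).indicator
    fun x => ‖extOp (closedCube 0 1) (fun η => f (c + σ • η)) x‖ₑ ^ P with hG
  have hGm : Measurable G := (measurable_enorm_extOp_rpow (hf.affine c σ)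
    (volume_ne_top_of_subset_closedCube subset_rfl) P).indicator hB
  rw [← lintegral_indicator hB, ← lintegral_indicator hB, ← hG, mul_assoc,
    ← lintegral_comp_parabolicMap c hσ hGm, ← lintegral_const_mul' _ _ (by finiteness)]
  refine lintegral_mono fun x => ?_
  by_cases hx : x ∈ Metric.closedBall (0 : Phys n) R
  · rw [Set.indicator_of_mem hx, hG, Set.indicator_of_mem (parabolicMap_mem_closedBall hσ h hx),
      enorm_extOp_rescale (measurableSet_closedCube c σ) f c hσ, ENNReal.mul_rpow_of_nonneg _ _ hP,
      preimage_closedCube c c σ hσ]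
    simp [div_self hσ.ne']
  · rw [Set.indicator_of_notMem hx]
    exact zero_le

/-! ### Rescaling the bilinear estimate. -/

/-- The bilinear extension estimate for pairs of functions bounded by one, with constant `C`. -/
def UnitBilinearBound (n : ℕ) (P : ℝ) (C : ℝ≥0∞) : Prop :=
  ∀ Ω₁ Ω₂ : Set (Freq n), IsCube Ω₁ → IsCube Ω₂ →
    Ω₁ ⊆ closedCube 0 1 → Ω₂ ⊆ closedCube 0 1 → ENNReal.ofReal (1 / 2) ≤ setDist Ω₁ Ω₂ →
    ∀ g₁ g₂ : Freq n → ℂ, UnitBounded g₁ → UnitBounded g₂ →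
      ∫⁻ x : Phys n, ‖extOp Ω₁ g₁ x * extOp Ω₂ g₂ x‖ₑ ^ (P / 2) ≤ C

/-- Two cubes of equal size whose centres are far apart relative to their size satisfy a bilinear
estimate, by parabolic rescaling. -/
lemma UnitBilinearBound.rescale {n : ℕ} {P : ℝ} (hP : 0 ≤ P) {C : ℝ≥0∞}
    (hC : UnitBilinearBound n P C) (hCt : C ≠ ∞) {c₁ c₂ : Freq n} {ρ : ℝ} (hρ : 0 < ρ)
    (hsep : ∃ j, 4 * ρ ≤ |c₁ j - c₂ j|) :
    ∃ C' : ℝ≥0∞, C' ≠ ∞ ∧ ∀ g₁ g₂ : Freq n → ℂ, UnitBounded g₁ → UnitBounded g₂ →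
      ∫⁻ x : Phys n, ‖extOp (closedCube c₁ ρ) g₁ x * extOp (closedCube c₂ ρ) g₂ x‖ₑ ^ (P / 2)
        ≤ C' := by
  obtain ⟨j₀, hj₀⟩ := hsep
  have : Nonempty (Fin (n - 1)) := ⟨j₀⟩
  -- The coordinate of largest separation serves twice: it bounds the other coordinates, so that
  -- both cubes fit after rescaling, and it witnesses their distance.
  obtain ⟨i, hi⟩ := Finite.exists_max fun j => |c₁ j - c₂ j|
  set M : ℝ := |c₁ i - c₂ i| with hM
  have hM4 : 4 * ρ ≤ M := hj₀.trans (hi j₀)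
  -- Seen from the midpoint `c₀`, both cubes lie in the cube of half-side `M / 2 + ρ`, which is
  -- rescaled to `[-1,1]^{n-1}`.
  set σ : ℝ := M / 2 + ρ with hσdef
  have hσ : 0 < σ := by linarith
  set c₀ : Freq n := (1 / 2 : ℝ) • (c₁ + c₂) with hc₀
  have hd1 : ∀ j, c₁ j - c₀ j = (c₁ j - c₂ j) / 2 := fun j => by
    simp [hc₀]; ring
  have hd2 : ∀ j, c₂ j - c₀ j = (c₂ j - c₁ j) / 2 := fun j => by
    simp [hc₀]; ring
  have hsub : ∀ c : Freq n, (∀ j, |c j - c₀ j| ≤ M / 2) →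
      closedCube (σ⁻¹ • (c - c₀)) (ρ / σ) ⊆ closedCube (0 : Freq n) 1 := by
    intro c hc ξ hξ j
    have h1 := hξ j
    simp only [PiLp.smul_apply, PiLp.sub_apply, smul_eq_mul] at h1
    simp only [PiLp.zero_apply, sub_zero]
    have h2 : |σ⁻¹ * (c j - c₀ j)| ≤ (M / 2) / σ := by
      rw [abs_mul, abs_of_pos (inv_pos.2 hσ), inv_mul_eq_div]
      gcongr
      exact hc j
    calc |ξ j| ≤ |ξ j - σ⁻¹ * (c j - c₀ j)| + |σ⁻¹ * (c j - c₀ j)| := by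
          simpa using abs_add_le (ξ j - σ⁻¹ * (c j - c₀ j)) (σ⁻¹ * (c j - c₀ j))
      _ ≤ ρ / σ + (M / 2) / σ := add_le_add h1 h2
      _ = 1 := by rw [← add_div, add_comm, ← hσdef, div_self hσ.ne']
  have hdist : ENNReal.ofReal (1 / 2) ≤ setDist (closedCube (σ⁻¹ • (c₁ - c₀)) (ρ / σ))
      (closedCube (σ⁻¹ • (c₂ - c₀)) (ρ / σ)) := by
    refine le_iInf₂ fun ξ hξ => le_iInf₂ fun η hη => ?_
    rw [edist_dist]
    refine ENNReal.ofReal_le_ofReal ?_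
    have h1 := hξ i
    have h2 := hη i
    simp only [PiLp.smul_apply, PiLp.sub_apply, smul_eq_mul, hd1, hd2] at h1 h2
    have h3 : |ξ i - η i| ≤ dist ξ η := by
      rw [dist_eq_norm]
      simpa using PiLp.norm_apply_le (ξ - η) i
    refine le_trans ?_ h3
    have h4 : M / σ = |σ⁻¹ * ((c₁ i - c₂ i) / 2) - σ⁻¹ * ((c₂ i - c₁ i) / 2)| := by
      have : σ⁻¹ * ((c₁ i - c₂ i) / 2) - σ⁻¹ * ((c₂ i - c₁ i) / 2) = (c₁ i - c₂ i) / σ := by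
        field_simp; ring
      rw [this, abs_div, abs_of_pos hσ]
    have h5 : M / σ ≤ |ξ i - η i| + ρ / σ + ρ / σ := by
      rw [h4]
      rw [abs_le] at h1 h2
      refine abs_le.2 ⟨?_, ?_⟩
      · have := neg_abs_le (ξ i - η i); linarith [h1.1, h1.2, h2.1, h2.2]
      · have := le_abs_self (ξ i - η i); linarith [h1.1, h1.2, h2.1, h2.2]
    -- The numerator below is `3M/4 - 5ρ/2`, nonnegative because `M ≥ 4ρ`.
    have h6 : 1 / 2 + ρ / σ + ρ / σ ≤ M / σ := by
      rw [← sub_nonneg]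
      have : M / σ - (1 / 2 + ρ / σ + ρ / σ) = (M - σ / 2 - 2 * ρ) / σ := by
        field_simp; ring
      rw [this]
      apply div_nonneg _ hσ.le
      rw [hσdef]; linarith
    linarith
  have hcube : ∀ c : Freq n, IsCube (closedCube (σ⁻¹ • (c - c₀)) (ρ / σ)) :=
    fun c => ⟨_, _, div_pos hρ hσ, rfl⟩
  have hs1 : closedCube (σ⁻¹ • (c₁ - c₀)) (ρ / σ) ⊆ closedCube (0 : Freq n) 1 := by
    refine hsub c₁ fun j => ?_
    rw [hd1, abs_div, abs_two]
    exact div_le_div_of_nonneg_right (hi j) zero_le_two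
  have hs2 : closedCube (σ⁻¹ • (c₂ - c₀)) (ρ / σ) ⊆ closedCube (0 : Freq n) 1 := by
    refine hsub c₂ fun j => ?_
    rw [hd2, abs_div, abs_two, abs_sub_comm]
    exact div_le_div_of_nonneg_right (hi j) zero_le_two
  refine ⟨(ENNReal.ofReal (σ ^ (n - 1)) * ENNReal.ofReal (σ ^ (n - 1))) ^ (P / 2) *
    (ENNReal.ofReal ((σ ^ (n - 1 + 2))⁻¹) * C), ?_, fun g₁ g₂ hg₁ hg₂ => ?_⟩
  · have : 0 ≤ P / 2 := by linarith
    finiteness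
  · set Ω₁ := closedCube (σ⁻¹ • (c₁ - c₀)) (ρ / σ)
    set Ω₂ := closedCube (σ⁻¹ • (c₂ - c₀)) (ρ / σ)
    have key := hC Ω₁ Ω₂ (hcube c₁) (hcube c₂) hs1 hs2 hdist _ _ (hg₁.affine c₀ σ)
      (hg₂.affine c₀ σ)
    have hGm : Measurable fun x : Phys n => ‖extOp Ω₁ (fun η => g₁ (c₀ + σ • η)) x *
        extOp Ω₂ (fun η => g₂ (c₀ + σ • η)) x‖ₑ ^ (P / 2) := by
      have m1 := ((hg₁.affine c₀ σ).continuous_extOp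
        (volume_ne_top_of_subset_closedCube hs1)).measurable
      have m2 := ((hg₂.affine c₀ σ).continuous_extOp
        (volume_ne_top_of_subset_closedCube hs2)).measurable
      exact ((m1.mul m2).enorm).pow_const _
    have hP2 : 0 ≤ P / 2 := by linarith
    calc ∫⁻ x : Phys n, ‖extOp (closedCube c₁ ρ) g₁ x * extOp (closedCube c₂ ρ) g₂ x‖ₑ ^ (P / 2)
        = ∫⁻ x : Phys n, (ENNReal.ofReal (σ ^ (n - 1)) * ENNReal.ofReal (σ ^ (n - 1))) ^ (P / 2) *
          ‖extOp Ω₁ (fun η => g₁ (c₀ + σ • η)) (parabolicMap c₀ σ x) *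
          extOp Ω₂ (fun η => g₂ (c₀ + σ • η)) (parabolicMap c₀ σ x)‖ₑ ^ (P / 2) := by
          congr 1 with x
          rw [enorm_mul, enorm_extOp_rescale (measurableSet_closedCube c₁ ρ) g₁ c₀ hσ,
            enorm_extOp_rescale (measurableSet_closedCube c₂ ρ) g₂ c₀ hσ,
            preimage_closedCube _ _ _ hσ, preimage_closedCube _ _ _ hσ, mul_mul_mul_comm,
            ENNReal.mul_rpow_of_nonneg _ _ hP2, enorm_mul]
      _ = (ENNReal.ofReal (σ ^ (n - 1)) * ENNReal.ofReal (σ ^ (n - 1))) ^ (P / 2) *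
          (ENNReal.ofReal ((σ ^ (n - 1 + 2))⁻¹) *
          ∫⁻ x : Phys n, ‖extOp Ω₁ (fun η => g₁ (c₀ + σ • η)) x *
            extOp Ω₂ (fun η => g₂ (c₀ + σ • η)) x‖ₑ ^ (P / 2)) := by
          rw [lintegral_const_mul' _ _ (by finiteness), lintegral_comp_parabolicMap c₀ hσ hGm]
      _ ≤ _ := by gcongr

/-! ### The broad-narrow inequality. -/

/-- Pointwise bilinear-to-linear inequality: a sum is controlled by its largest term, multiplied by
the number of its neighbours, and by the geometric means of the pairs of non-neighbouring terms. -/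
lemma enorm_sum_le_broad_narrow {ι : Type*} [Fintype ι] [Nonempty ι] (z : ι → ℂ)
    (adj : ι → ι → Prop) [DecidableRel adj] {M : ℕ}
    (hM : ∀ k, (Finset.univ.filter (adj k)).card ≤ M) :
    ∃ k₀, ‖∑ k, z k‖ₑ ≤ M * ‖z k₀‖ₑ +
      ∑ q ∈ Finset.univ.filter (fun q : ι × ι => ¬ adj q.1 q.2),
        ‖z q.1 * z q.2‖ₑ ^ (1 / 2 : ℝ) := by
  classical
  obtain ⟨k₀, hk₀⟩ := Finite.exists_max fun k => ‖z k‖ₑ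
  refine ⟨k₀, ?_⟩
  calc ‖∑ k, z k‖ₑ ≤ ∑ k, ‖z k‖ₑ := enorm_sum_le _ _
    _ = ∑ k ∈ Finset.univ.filter (adj k₀), ‖z k‖ₑ +
        ∑ k ∈ Finset.univ.filter (fun k => ¬ adj k₀ k), ‖z k‖ₑ :=
        (Finset.sum_filter_add_sum_filter_not _ _ _).symm
    _ ≤ M * ‖z k₀‖ₑ + ∑ k ∈ Finset.univ.filter (fun k => ¬ adj k₀ k),
          ‖z k₀ * z k‖ₑ ^ (1 / 2 : ℝ) := by
        refine add_le_add ?_ (Finset.sum_le_sum fun k _ => ?_)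
        · calc ∑ k ∈ Finset.univ.filter (adj k₀), ‖z k‖ₑ
              ≤ ∑ k ∈ Finset.univ.filter (adj k₀), ‖z k₀‖ₑ := Finset.sum_le_sum fun k _ => hk₀ k
            _ = (Finset.univ.filter (adj k₀)).card * ‖z k₀‖ₑ := by simp
            _ ≤ M * ‖z k₀‖ₑ := by gcongr; exact hM k₀
        -- Since `z k₀` is the largest term, `|z k|` is at most the geometric mean of `|z k₀|` and
        -- `|z k|`.
        · have : ‖z k‖ₑ = (‖z k‖ₑ * ‖z k‖ₑ) ^ (1 / 2 : ℝ) := by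
            rw [ENNReal.mul_rpow_of_nonneg _ _ (by norm_num), ← ENNReal.rpow_add_of_nonneg] <;>
              norm_num
          rw [this, enorm_mul]
          gcongr
          exact hk₀ k
    _ ≤ _ := by
        gcongr
        -- Enlarging the sum to all non-neighbouring pairs removes its dependence on `k₀`, which
        -- will vary with the point of physical space.
        rw [← Finset.sum_image (s := Finset.univ.filter (fun k => ¬ adj k₀ k))
          (g := fun k => (k₀, k)) (f := fun q : ι × ι => ‖z q.1 * z q.2‖ₑ ^ (1 / 2 : ℝ))
          (fun a _ b _ h => (Prod.ext_iff.1 h).2)]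
        refine Finset.sum_le_sum_of_subset fun q hq => ?_
        obtain ⟨k, hk, rfl⟩ := Finset.mem_image.1 hq
        simpa using hk

/-- Convexity of the `P`-th power is used once for the two parts and once for the sum over pairs.
The largest term is replaced by the sum of all terms, which can be integrated tile by tile. -/
lemma enorm_sum_rpow_le_broad_narrow {ι : Type*} [Fintype ι] [Nonempty ι] (z : ι → ℂ)
    (adj : ι → ι → Prop) [DecidableRel adj] {M : ℕ}
    (hM : ∀ k, (Finset.univ.filter (adj k)).card ≤ M) {P : ℝ} (hP : 1 ≤ P) :
    ‖∑ k, z k‖ₑ ^ P ≤ 2 ^ (P - 1) * (M : ℝ≥0∞) ^ P * ∑ k, ‖z k‖ₑ ^ P +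
      2 ^ (P - 1) *
        ((Finset.univ.filter (fun q : ι × ι => ¬ adj q.1 q.2)).card : ℝ≥0∞) ^ (P - 1) *
        ∑ q ∈ Finset.univ.filter (fun q : ι × ι => ¬ adj q.1 q.2),
          ‖z q.1 * z q.2‖ₑ ^ (P / 2) := by
  have hP0 : 0 ≤ P := by linarith
  obtain ⟨k₀, hk₀⟩ := enorm_sum_le_broad_narrow z adj hM
  refine (ENNReal.rpow_le_rpow hk₀ hP0).trans
    ((ENNReal.rpow_add_le_mul_rpow_add_rpow _ _ hP).trans ?_)
  rw [mul_add, mul_assoc, mul_assoc]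
  gcongr
  · rw [ENNReal.mul_rpow_of_nonneg _ _ hP0]
    gcongr
    exact Finset.single_le_sum (f := fun k => ‖z k‖ₑ ^ P) (fun _ _ => zero_le)
      (Finset.mem_univ k₀)
  · refine (ENNReal.rpow_sum_le_const_mul_sum_rpow _ _ hP).trans (le_of_eq ?_)
    congr 1
    refine Finset.sum_congr rfl fun q _ => ?_
    rw [← ENNReal.rpow_mul]
    congr 1
    ring

/-! ### The tiling of the frequency cube. -/

/-- Centres of the `K^{n-1}` cubes of side length `2 / K` which tile `[-1,1]^{n-1}`. -/
noncomputable def gridCenter {n : ℕ} (K : ℕ) (k : Fin (n - 1) → Fin K) : Freq n :=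
  WithLp.toLp 2 fun j => -1 + (2 * (k j : ℝ) + 1) / K

/-- The index of a tile containing a given point of `[-1,1]^{n-1}`. -/
noncomputable def gridIndex {n : ℕ} (K : ℕ) [NeZero K] (ξ : Freq n) : Fin (n - 1) → Fin K :=
  -- The cap at `K - 1` assigns the face `ξ j = 1` to the last tile.
  fun j => ⟨min ⌊(ξ j + 1) * K / 2⌋₊ (K - 1),
    (min_le_right _ _).trans_lt (Nat.sub_lt (NeZero.pos K) one_pos)⟩

lemma measurable_gridIndex {n : ℕ} (K : ℕ) [NeZero K] :
    Measurable (gridIndex K : Freq n → Fin (n - 1) → Fin K) := by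
  refine measurable_pi_lambda _ fun j => ?_
  have h : Measurable fun m : ℕ => (⟨min m (K - 1),
    (min_le_right _ _).trans_lt (Nat.sub_lt (NeZero.pos K) one_pos)⟩ : Fin K) :=
    measurable_from_nat
  have h2 : Measurable fun ξ : Freq n => ⌊(ξ j + 1) * K / 2⌋₊ :=
    Nat.measurable_floor.comp (by fun_prop)
  exact h.comp h2

lemma mem_closedCube_gridIndex {n : ℕ} (K : ℕ) [NeZero K] {ξ : Freq n}
    (hξ : ξ ∈ closedCube 0 1) : ξ ∈ closedCube (gridCenter K (gridIndex K ξ)) (1 / K) := by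
  intro j
  have hK : (0 : ℝ) < K := by exact_mod_cast NeZero.pos K
  have h1 := abs_le.1 (hξ j)
  simp only [PiLp.zero_apply, sub_zero] at h1
  set y : ℝ := (ξ j + 1) * K / 2 with hy
  have hy0 : 0 ≤ y := by
    have : 0 ≤ ξ j + 1 := by linarith
    positivity
  have hyK : y ≤ K := by nlinarith
  set i : ℕ := min ⌊y⌋₊ (K - 1) with hi
  have hi1 : (i : ℝ) ≤ y := le_trans (by exact_mod_cast min_le_left _ _) (Nat.floor_le hy0)
  have hi2 : y ≤ i + 1 := by
    rcases le_total ⌊y⌋₊ (K - 1) with h | h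
    · rw [hi, min_eq_left h]; exact (Nat.lt_floor_add_one y).le
    · rw [hi, min_eq_right h]
      have : ((K - 1 : ℕ) : ℝ) + 1 = K := by
        exact_mod_cast Nat.sub_add_cancel (NeZero.pos K)
      rw [this]; exact hyK
  have hc : (gridCenter K (gridIndex K ξ) : Freq n) j = -1 + (2 * (i : ℝ) + 1) / K := rfl
  have hξj : ξ j = 2 * y / K - 1 := by rw [hy]; field_simp; ring
  have : ξ j - (-1 + (2 * (i : ℝ) + 1) / K) = (2 * (y - i) - 1) / K := by
    rw [hξj]; field_simp; ring
  rw [hc, this, abs_div, abs_of_pos hK]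
  gcongr
  rw [abs_le]; constructor <;> linarith

lemma closedCube_gridCenter_subset {n : ℕ} (K : ℕ) [NeZero K] (k : Fin (n - 1) → Fin K) :
    closedCube (gridCenter K k) (1 / K) ⊆ closedCube (0 : Freq n) 1 := by
  intro ξ hξ j
  have hK : (0 : ℝ) < K := by exact_mod_cast NeZero.pos K
  have h1 := abs_le.1 (hξ j)
  have hc : (gridCenter K k : Freq n) j = -1 + (2 * (k j : ℝ) + 1) / K := rfl
  have hk : ((k j : ℕ) : ℝ) + 1 ≤ K := by exact_mod_cast (k j).2
  rw [hc] at h1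
  have h2 : (2 * ((k j : ℕ) : ℝ) + 1) / K + 1 / K ≤ 2 := by
    rw [← add_div, div_le_iff₀ hK]; linarith
  have h3 : 0 ≤ (2 * ((k j : ℕ) : ℝ) + 1) / K - 1 / K := by
    rw [← sub_div]; apply div_nonneg _ hK.le
    have : (0 : ℝ) ≤ (k j : ℕ) := Nat.cast_nonneg _
    linarith
  simp only [PiLp.zero_apply, sub_zero]
  rw [abs_le]; constructor <;> linarith [h1.1, h1.2]

lemma gridCenter_mem {n : ℕ} (K : ℕ) [NeZero K] (k : Fin (n - 1) → Fin K) :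
    (gridCenter K k : Freq n) ∈ closedCube (0 : Freq n) 1 :=
  closedCube_gridCenter_subset K k fun j => by simp

lemma UnitBounded.integrableOn_extOp {n : ℕ} {f : Freq n → ℂ} (hf : UnitBounded f)
    {Ω : Set (Freq n)} (hΩ : volume Ω ≠ ∞) (x : Phys n) :
    IntegrableOn (fun ξ => f ξ * Complex.exp (2 * Real.pi * Complex.I *
      ((inner ℝ x.1 ξ + x.2 * ‖ξ‖ ^ 2 : ℝ) : ℂ))) Ω := by
  have : IsFiniteMeasure (volume.restrict Ω) := ⟨by simpa using hΩ.lt_top⟩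
  refine Integrable.of_bound (C := 1) ?_ (Filter.Eventually.of_forall fun ξ => ?_)
  · have h1 := hf.1
    refine Measurable.aestronglyMeasurable ?_
    fun_prop
  · rw [norm_mul, norm_cexp_two_pi_I_mul, mul_one]
    exact hf.2 ξ

/-- The closed tiles share faces, so `f` is cut along the fibres of `gridIndex`, which are disjoint.
On the fibre over `k`, lying in the tile and lying in `[-1,1]^{n-1}` are equivalent. -/
lemma extOp_eq_sum_grid {n : ℕ} (K : ℕ) [NeZero K] {f : Freq n → ℂ} (hf : UnitBounded f)
    (x : Phys n) :
    extOp (closedCube 0 1) f x = ∑ k : Fin (n - 1) → Fin K,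
      extOp (closedCube (gridCenter K k) (1 / K)) ((gridIndex K ⁻¹' {k}).indicator f) x := by
  have hmeas : ∀ k : Fin (n - 1) → Fin K, MeasurableSet (gridIndex (n := n) K ⁻¹' {k}) :=
    fun k => measurable_gridIndex K (measurableSet_singleton k)
  have hstep : ∀ k : Fin (n - 1) → Fin K,
      extOp (closedCube (gridCenter K k) (1 / K)) ((gridIndex K ⁻¹' {k}).indicator f) x =
      extOp (closedCube 0 1) ((gridIndex K ⁻¹' {k}).indicator f) x := by
    intro k
    unfold extOp
    rw [← integral_indicator (measurableSet_closedCube _ _),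
      ← integral_indicator (measurableSet_closedCube _ _)]
    congr 1 with ξ
    by_cases hk : gridIndex K ξ = k
    · have : ξ ∈ closedCube (gridCenter K k) (1 / K) ↔ ξ ∈ closedCube (0 : Freq n) 1 :=
        ⟨fun h => closedCube_gridCenter_subset K k h, fun h => hk ▸ mem_closedCube_gridIndex K h⟩
      by_cases h0 : ξ ∈ closedCube (0 : Freq n) 1
      · rw [Set.indicator_of_mem h0, Set.indicator_of_mem (this.2 h0)]
      · rw [Set.indicator_of_notMem h0, Set.indicator_of_notMem fun h => h0 (this.1 h)]
    · have : ξ ∉ gridIndex K ⁻¹' {k} := hk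
      simp [Set.indicator, hk]
  simp only [hstep]
  unfold extOp
  rw [← integral_finsetSum]
  · congr 1 with ξ
    rw [← Finset.sum_mul]
    congr 1
    simp [Set.indicator]
  · intro k _
    exact (hf.indicator (hmeas k)).integrableOn_extOp
      (volume_ne_top_of_subset_closedCube subset_rfl) x

/-- Two tiles are neighbours if their indices differ by at most one in every coordinate. -/
def GridAdj {d K : ℕ} (k l : Fin d → Fin K) : Prop :=
  ∀ j, |((k j : ℕ) : ℤ) - ((l j : ℕ) : ℤ)| ≤ 1

open scoped Classical in
lemma card_gridAdj_le {d K : ℕ} (k : Fin d → Fin K) :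
    (Finset.univ.filter (GridAdj k)).card ≤ 3 ^ d := by
  have h : Finset.univ.filter (GridAdj k) ⊆ Fintype.piFinset fun j =>
      Finset.univ.filter fun l : Fin K => |((k j : ℕ) : ℤ) - ((l : ℕ) : ℤ)| ≤ 1 := by
    intro l hl
    simpa [Fintype.mem_piFinset, GridAdj] using hl
  refine (Finset.card_le_card h).trans ?_
  rw [Fintype.card_piFinset]
  refine (Finset.prod_le_pow_card _ _ 3 fun j _ => ?_).trans (by simp)
  have h3 : (Finset.Icc (((k j : ℕ) : ℤ) - 1) (((k j : ℕ) : ℤ) + 1)).card = 3 := by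
    rw [Int.card_Icc]; omega
  rw [← h3]
  refine Finset.card_le_card_of_injOn (fun l : Fin K => ((l : ℕ) : ℤ)) ?_ ?_
  · intro l hl
    have : |((k j : ℕ) : ℤ) - ((l : ℕ) : ℤ)| ≤ 1 := by simpa using hl
    rw [abs_le] at this
    simp only [Finset.coe_Icc, Set.mem_Icc]
    omega
  · intro a _ b _ hab
    have : ((a : ℕ) : ℤ) = ((b : ℕ) : ℤ) := hab
    exact Fin.ext (by exact_mod_cast this)

/-- Non-neighbours have some coordinate in which the indices differ by at least two, and consecutive
centres are `2 / K` apart. With `ρ = 1 / K` this is the separation `4 * ρ` required by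
`UnitBilinearBound.rescale`. -/
lemma gridCenter_separated {n K : ℕ} [NeZero K] {k l : Fin (n - 1) → Fin K} (h : ¬ GridAdj k l) :
    ∃ j, 4 * (1 / (K : ℝ)) ≤ |(gridCenter K k : Freq n) j - (gridCenter K l : Freq n) j| := by
  obtain ⟨j, hj⟩ := not_forall.1 h
  refine ⟨j, ?_⟩
  have hK : (0 : ℝ) < K := by exact_mod_cast NeZero.pos K
  have h2 : (2 : ℤ) ≤ |((k j : ℕ) : ℤ) - ((l j : ℕ) : ℤ)| := by omega
  have h3 : (2 : ℝ) ≤ |((k j : ℕ) : ℝ) - ((l j : ℕ) : ℝ)| := by exact_mod_cast h2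
  have : (gridCenter K k : Freq n) j - (gridCenter K l : Freq n) j =
      2 * (((k j : ℕ) : ℝ) - ((l j : ℕ) : ℝ)) / K := by
    simp only [gridCenter]; ring
  rw [this, abs_div, abs_mul, abs_two, abs_of_pos hK, mul_one_div]
  gcongr
  linarith

/-! ### The self-improving estimate. -/

/-- The constant gained by parabolic rescaling is eventually small when `p > 2 (d + 1) / d`. -/
lemma exists_scale {d : ℕ} {P : ℝ} (hP : 2 * (d + 1) < d * P) (B : ℝ) (N : ℕ) :
    ∃ K : ℕ, N ≤ K ∧ 0 < K ∧
      ENNReal.ofReal B * ((K : ℝ≥0∞) ^ d * (ENNReal.ofReal ((1 / (K : ℝ)) ^ d) ^ P *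
        ENNReal.ofReal (((1 / (K : ℝ)) ^ (d + 2))⁻¹))) ≤ 1 / 2 := by
  have ht : Filter.Tendsto (fun K : ℕ => B * (K : ℝ) ^ (-(d * P - 2 * (d + 1))))
      Filter.atTop (nhds (B * 0)) :=
    (((tendsto_rpow_neg_atTop (sub_pos.2 hP)).comp tendsto_natCast_atTop_atTop)).const_mul B
  have h1 := ht.eventually_le_const (show B * 0 < (1 / 2 : ℝ) by norm_num)
  obtain ⟨K, hK1, hK2, hK3⟩ := (h1.and ((Filter.eventually_ge_atTop N).and
    (Filter.eventually_gt_atTop 0))).exists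
  refine ⟨K, hK2, hK3, ?_⟩
  have hK : (0 : ℝ) < K := by exact_mod_cast hK3
  have e1 : (K : ℝ≥0∞) ^ d = ENNReal.ofReal ((K : ℝ) ^ d) := by
    rw [ENNReal.ofReal_pow hK.le, ENNReal.ofReal_natCast]
  rw [e1, ENNReal.ofReal_rpow_of_pos (by positivity), ← ENNReal.ofReal_mul (by positivity),
    ← ENNReal.ofReal_mul (by positivity), ← ENNReal.ofReal_mul' (by positivity)]
  -- The exponent collects `d` from the number of tiles, `-dP` from the amplitude of a rescaled
  -- extension and `d + 2` from the Jacobian.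
  have e2 : (K : ℝ) ^ d * (((1 / (K : ℝ)) ^ d) ^ P * ((1 / (K : ℝ)) ^ (d + 2))⁻¹) =
      (K : ℝ) ^ (-(d * P - 2 * (d + 1))) := by
    rw [one_div, inv_pow, inv_pow, inv_inv, ← Real.rpow_natCast, ← Real.rpow_natCast,
      ← Real.rpow_neg hK.le, ← Real.rpow_mul hK.le, ← Real.rpow_add hK, ← Real.rpow_add hK]
    congr 1
    push_cast
    ring
  rw [e2]
  refine (ENNReal.ofReal_le_ofReal hK1).trans (le_of_eq ?_)
  rw [ENNReal.ofReal_div_of_pos two_pos]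
  simp

/-- The bilinear estimate implies the linear one, for functions bounded by one and uniformly over
all balls of physical space. -/
lemma exists_local_bound_of_bilinear {n : ℕ} {P : ℝ} (hP1 : 1 ≤ P)
    (hP : 2 * (((n - 1 : ℕ) : ℝ) + 1) < ((n - 1 : ℕ) : ℝ) * P) {C : ℝ≥0∞}
    (hC : UnitBilinearBound n P C) (hCt : C ≠ ∞) :
    ∃ A : ℝ≥0∞, A ≠ ∞ ∧ ∀ R : ℝ, ∀ f : Freq n → ℂ, UnitBounded f →
      ∫⁻ x in Metric.closedBall (0 : Phys n) R, ‖extOp (closedCube 0 1) f x‖ₑ ^ P ≤ A := by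
  classical
  have hP0 : 0 ≤ P := by linarith
  set M : ℕ := 3 ^ (n - 1) with hM
  set B : ℝ≥0∞ := 2 ^ (P - 1) * (M : ℝ≥0∞) ^ P with hB
  have hBt : B ≠ ∞ := by
    have : 0 ≤ P - 1 := by linarith
    finiteness
  -- Centres have norm at most `n`, so `K ≥ 1 + 2n` makes rescaling to a tile preserve every ball
  -- about the origin.
  obtain ⟨K, hNK, hK, hsmall⟩ := exists_scale hP B.toReal (1 + 2 * n)
  rw [ENNReal.ofReal_toReal hBt] at hsmall
  have : NeZero K := ⟨hK.ne'⟩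
  have hKr : (0 : ℝ) < K := by exact_mod_cast hK
  have hσ : (0 : ℝ) < 1 / K := by positivity
  -- From here on `K` is fixed, so the bilinear constants may depend on the pair of tiles; there are
  -- finitely many pairs.
  have hbil : ∀ q : (Fin (n - 1) → Fin K) × (Fin (n - 1) → Fin K), ∃ C' : ℝ≥0∞, C' ≠ ∞ ∧
      (¬ GridAdj q.1 q.2 → ∀ g₁ g₂ : Freq n → ℂ, UnitBounded g₁ → UnitBounded g₂ →
      ∫⁻ x : Phys n, ‖extOp (closedCube (gridCenter K q.1) (1 / K)) g₁ x *
        extOp (closedCube (gridCenter K q.2) (1 / K)) g₂ x‖ₑ ^ (P / 2) ≤ C') := by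
    intro q
    by_cases hq : GridAdj q.1 q.2
    · exact ⟨0, by simp, fun h => absurd hq h⟩
    · obtain ⟨C', h1, h2⟩ := hC.rescale hP0 hCt hσ (gridCenter_separated (n := n) hq)
      exact ⟨C', h1, fun _ => h2⟩
  choose C' hC't hC' using hbil
  set S := Finset.univ.filter
    (fun q : (Fin (n - 1) → Fin K) × (Fin (n - 1) → Fin K) => ¬ GridAdj q.1 q.2) with hS
  set D : ℝ≥0∞ := 2 ^ (P - 1) * (S.card : ℝ≥0∞) ^ (P - 1) * ∑ q ∈ S, C' q with hD
  have hDt : D ≠ ∞ := by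
    have : 0 ≤ P - 1 := by linarith
    have : ∑ q ∈ S, C' q ≠ ∞ := ENNReal.sum_ne_top.2 fun q _ => hC't q
    finiteness
  -- The inequality `A ≤ A/2 + D` gives `A ≤ 2D`, and `D` was chosen before `R`.
  refine ⟨2 * D, by finiteness, fun R => ?_⟩
  set A : ℝ≥0∞ := ⨆ f : {f : Freq n → ℂ // UnitBounded f},
    ∫⁻ x in Metric.closedBall (0 : Phys n) R, ‖extOp (closedCube 0 1) f.1 x‖ₑ ^ P with hA
  have hle : ∀ f : Freq n → ℂ, UnitBounded f →
      ∫⁻ x in Metric.closedBall (0 : Phys n) R, ‖extOp (closedCube 0 1) f x‖ₑ ^ P ≤ A :=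
    fun f hf => le_iSup (fun f : {f : Freq n → ℂ // UnitBounded f} =>
      ∫⁻ x in Metric.closedBall (0 : Phys n) R, ‖extOp (closedCube 0 1) f.1 x‖ₑ ^ P) ⟨f, hf⟩
  have hvol : volume (closedCube (0 : Freq n) 1) ≠ ∞ :=
    volume_ne_top_of_subset_closedCube subset_rfl
  -- Finiteness of `A` is what permits cancelling `A / 2`; it is the reason for localizing to a
  -- ball.
  have hAt : A ≠ ∞ := by
    refine ne_top_of_le_ne_top (b := volume (closedCube (0 : Freq n) 1) ^ P *
      volume (Metric.closedBall (0 : Phys n) R)) ?_ (iSup_le fun f => ?_)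
    · have := (measure_closedBall_lt_top (μ := (volume : Measure (Phys n))) (x := 0) (r := R)).ne
      finiteness
    · rw [← setLIntegral_const]
      refine lintegral_mono fun x => ?_
      gcongr
      exact f.2.enorm_extOp_le _ x
  have hstep : ∀ f : Freq n → ℂ, UnitBounded f →
      ∫⁻ x in Metric.closedBall (0 : Phys n) R, ‖extOp (closedCube 0 1) f x‖ₑ ^ P ≤
        1 / 2 * A + D := by
    intro f hf
    set g : (Fin (n - 1) → Fin K) → Freq n → ℂ :=
      fun k => (gridIndex K ⁻¹' {k}).indicator f with hg
    have hgb : ∀ k, UnitBounded (g k) :=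
      fun k => hf.indicator (measurable_gridIndex K (measurableSet_singleton k))
    have hvk : ∀ k : Fin (n - 1) → Fin K,
        volume (closedCube (gridCenter K k : Freq n) (1 / K)) ≠ ∞ :=
      fun k => volume_ne_top_of_subset_closedCube (closedCube_gridCenter_subset K k)
    have hm1 : ∀ k, Measurable fun x : Phys n =>
        ‖extOp (closedCube (gridCenter K k) (1 / K)) (g k) x‖ₑ ^ P :=
      fun k => measurable_enorm_extOp_rpow (hgb k) (hvk k) P
    have hm2 : ∀ q : (Fin (n - 1) → Fin K) × (Fin (n - 1) → Fin K), Measurable fun x : Phys n =>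
        ‖extOp (closedCube (gridCenter K q.1) (1 / K)) (g q.1) x *
          extOp (closedCube (gridCenter K q.2) (1 / K)) (g q.2) x‖ₑ ^ (P / 2) := fun q =>
      ((((hgb q.1).continuous_extOp (hvk _)).measurable.mul
        ((hgb q.2).continuous_extOp (hvk _)).measurable).enorm).pow_const _
    have hP1' : 0 ≤ P - 1 := by linarith
    calc ∫⁻ x in Metric.closedBall (0 : Phys n) R, ‖extOp (closedCube 0 1) f x‖ₑ ^ P
        ≤ ∫⁻ x in Metric.closedBall (0 : Phys n) R,
          (B * ∑ k, ‖extOp (closedCube (gridCenter K k) (1 / K)) (g k) x‖ₑ ^ P +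
            2 ^ (P - 1) * (S.card : ℝ≥0∞) ^ (P - 1) *
            ∑ q ∈ S, ‖extOp (closedCube (gridCenter K q.1) (1 / K)) (g q.1) x *
              extOp (closedCube (gridCenter K q.2) (1 / K)) (g q.2) x‖ₑ ^ (P / 2)) := by
          refine lintegral_mono fun x => ?_
          rw [extOp_eq_sum_grid K hf x]
          exact enorm_sum_rpow_le_broad_narrow _ GridAdj (fun k => card_gridAdj_le k) hP1
      _ = B * (∑ k, ∫⁻ x in Metric.closedBall (0 : Phys n) R,
            ‖extOp (closedCube (gridCenter K k) (1 / K)) (g k) x‖ₑ ^ P) +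
            2 ^ (P - 1) * (S.card : ℝ≥0∞) ^ (P - 1) *
            ∑ q ∈ S, ∫⁻ x in Metric.closedBall (0 : Phys n) R,
              ‖extOp (closedCube (gridCenter K q.1) (1 / K)) (g q.1) x *
              extOp (closedCube (gridCenter K q.2) (1 / K)) (g q.2) x‖ₑ ^ (P / 2) := by
          rw [lintegral_add_left (by fun_prop), lintegral_const_mul' _ _ hBt,
            lintegral_const_mul' _ _ (by finiteness), lintegral_finsetSum _ fun k _ => hm1 k,
            lintegral_finsetSum _ fun q _ => hm2 q]
      _ ≤ B * ∑ _k : Fin (n - 1) → Fin K, (ENNReal.ofReal ((1 / (K : ℝ)) ^ (n - 1)) ^ P *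
            ENNReal.ofReal (((1 / (K : ℝ)) ^ (n - 1 + 2))⁻¹) * A) + D := by
          rw [hD]
          gcongr with k hk k hk
          · refine (lintegral_extOp_small_cube_le hσ hP0 ?_ (hgb k)).trans ?_
            · have h1 := norm_le_of_mem_closedCube (gridCenter_mem (n := n) K k)
              have h2 : (1 + 2 * n : ℝ) ≤ K := by exact_mod_cast hNK
              rw [one_div, inv_mul_le_iff₀ hKr]
              linarith
            · gcongr
              exact hle _ ((hgb k).affine _ _)
          · exact (setLIntegral_le_lintegral _ _).trans
              (hC' k (by simpa [hS] using hk) _ _ (hgb _) (hgb _))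
      _ = B * ((K : ℝ≥0∞) ^ (n - 1) * (ENNReal.ofReal ((1 / (K : ℝ)) ^ (n - 1)) ^ P *
            ENNReal.ofReal (((1 / (K : ℝ)) ^ (n - 1 + 2))⁻¹))) * A + D := by
          simp only [Finset.sum_const, Finset.card_univ, Fintype.card_pi, Fintype.card_fin,
            Finset.prod_const, nsmul_eq_mul, Nat.cast_pow]
          ring
      _ ≤ 1 / 2 * A + D := by gcongr
  have hAle : A ≤ 1 / 2 * A + D := iSup_le fun f => hstep f.1 f.2
  intro f hf
  refine (hle f hf).trans ?_
  have h2 : A / 2 + A / 2 ≤ A / 2 + D := by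
    rw [ENNReal.add_halves]
    simpa [div_eq_mul_inv, mul_comm] using hAle
  have h3 : A / 2 ≤ D := (ENNReal.add_le_add_iff_left (by finiteness)).1 h2
  calc A = 2 * (A / 2) := by rw [two_mul, ENNReal.add_halves]
    _ ≤ 2 * D := by gcongr

lemma exists_bound_of_bilinear {n : ℕ} {P : ℝ} (hP1 : 1 ≤ P)
    (hP : 2 * (((n - 1 : ℕ) : ℝ) + 1) < ((n - 1 : ℕ) : ℝ) * P) {C : ℝ≥0∞}
    (hC : UnitBilinearBound n P C) (hCt : C ≠ ∞) :
    ∃ A : ℝ≥0∞, A ≠ ∞ ∧ ∀ f : Freq n → ℂ, UnitBounded f →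
      ∫⁻ x : Phys n, ‖extOp (closedCube 0 1) f x‖ₑ ^ P ≤ A := by
  obtain ⟨A, hA, h⟩ := exists_local_bound_of_bilinear hP1 hP hC hCt
  refine ⟨A, hA, fun f hf => ?_⟩
  have hmono : Monotone fun N : ℕ => Metric.closedBall (0 : Phys n) N :=
    fun a b hab => Metric.closedBall_subset_closedBall (by exact_mod_cast hab)
  rw [← setLIntegral_univ, ← Metric.iUnion_closedBall_nat (0 : Phys n),
    setLIntegral_iUnion_of_directed _ hmono.directed_le]
  exact iSup_le fun N => h N f hf

/-! ### From functions bounded by one to `L^∞`. -/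

lemma measurableSet_openUnitCube (n : ℕ) : MeasurableSet (openUnitCube n) := by
  have : openUnitCube n = ⋂ j, {ξ : Freq n | |ξ j| < 1} := by
    ext; simp [openUnitCube]
  rw [this]
  exact MeasurableSet.iInter fun j => (isOpen_lt (by fun_prop) continuous_const).measurableSet

lemma openUnitCube_subset (n : ℕ) : openUnitCube n ⊆ closedCube 0 1 := fun ξ hξ j => by
  simpa using (hξ j).le

lemma extOp_congr_ae {n : ℕ} {Ω : Set (Freq n)} {f g : Freq n → ℂ}
    (h : f =ᵐ[volume.restrict Ω] g) : extOp Ω f = extOp Ω g := by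
  funext x
  refine integral_congr_ae ?_
  filter_upwards [h] with ξ hξ
  rw [hξ]

lemma extOp_smul {n : ℕ} (Ω : Set (Freq n)) (a : ℂ) (f : Freq n → ℂ) :
    extOp Ω (fun ξ => a * f ξ) = fun x => a * extOp Ω f x := by
  funext x
  unfold extOp
  rw [← integral_const_mul]
  simp only [mul_assoc]

/-- Every essentially bounded function is a multiple of one bounded by one. -/
lemma exists_unitBounded {n : ℕ} {μ : Measure (Freq n)} {f : Freq n → ℂ} (hf : MemLp f ∞ μ) :
    ∃ g : Freq n → ℂ, UnitBounded g ∧ f =ᵐ[μ] fun ξ => ((eLpNorm f ∞ μ).toReal : ℂ) * g ξ := by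
  set m := (eLpNorm f ∞ μ).toReal with hm
  set f₀ := hf.1.mk f with hf₀
  have hf₀m : Measurable f₀ := hf.1.stronglyMeasurable_mk.measurable
  have hs : MeasurableSet {ξ | ‖f₀ ξ‖ ≤ m} := measurableSet_le hf₀m.norm measurable_const
  -- The truncation makes the bound hold everywhere rather than almost everywhere. If `m = 0` the
  -- inverse is zero by convention, which is consistent as `f` then vanishes almost everywhere.
  refine ⟨{ξ | ‖f₀ ξ‖ ≤ m}.indicator fun ξ => (m : ℂ)⁻¹ * f₀ ξ, ⟨?_, fun ξ => ?_⟩, ?_⟩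
  · exact (hf₀m.const_mul _).indicator hs
  · by_cases h : ξ ∈ {ξ | ‖f₀ ξ‖ ≤ m}
    · rw [Set.indicator_of_mem h, norm_mul, norm_inv, Complex.norm_real,
        Real.norm_of_nonneg (by positivity)]
      exact inv_mul_le_one_of_le₀ h (by positivity)
    · rw [Set.indicator_of_notMem h]; simp
  · have hbd : ∀ᵐ ξ ∂μ, ‖f ξ‖ₑ ≤ eLpNorm f ∞ μ := by
      rw [eLpNorm_exponent_top]; exact enorm_ae_le_eLpNormEssSup f μ
    filter_upwards [hf.1.ae_eq_mk, hbd] with ξ h1 h2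
    have h3 : ‖f₀ ξ‖ ≤ m := by
      rw [hf₀, ← h1, hm, ← toReal_enorm]
      exact ENNReal.toReal_mono hf.2.ne h2
    have h3' : ξ ∈ {ξ | ‖f₀ ξ‖ ≤ m} := h3
    rw [Set.indicator_of_mem h3', h1]
    by_cases h0 : m = 0
    · rw [h0] at h3
      have : f₀ ξ = 0 := norm_le_zero_iff.1 h3
      rw [← hf₀, this]; simp
    · rw [mul_inv_cancel_left₀ (by exact_mod_cast h0)]

/-- Homogeneity reduces to functions bounded by one, and extension by zero replaces the open cube by
the closed one, on which the tiling lives. -/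
lemma linearExtension_of_unitBounded {n : ℕ} {p : ℝ≥0∞} {A : ℝ≥0∞} (hA : A ≠ ∞)
    (h : ∀ f : Freq n → ℂ, UnitBounded f → eLpNorm (extOp (closedCube 0 1) f) p volume ≤ A) :
    LinearExtension n ∞ p := by
  refine ⟨A.toNNReal, fun f hf => ?_⟩
  obtain ⟨g, hg, hfg⟩ := exists_unitBounded hf
  rw [extOp_congr_ae hfg, extOp_smul, ENNReal.coe_toNNReal hA]
  have h1 : extOp (openUnitCube n) g = extOp (closedCube 0 1) ((openUnitCube n).indicator g) := by
    funext x
    unfold extOp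
    rw [← integral_indicator (measurableSet_openUnitCube n),
      ← integral_indicator (measurableSet_closedCube _ _)]
    congr 1 with ξ
    by_cases hξ : ξ ∈ openUnitCube n
    · simp [hξ, openUnitCube_subset n hξ]
    · simp [Set.indicator, hξ]
  rw [h1]
  have h2 := eLpNorm_const_smul (((eLpNorm f ∞ (volume.restrict (openUnitCube n))).toReal : ℝ) : ℂ)
    (extOp (closedCube 0 1) ((openUnitCube n).indicator g)) p (volume : Measure (Phys n))
  have h3 : ‖(((eLpNorm f ∞ (volume.restrict (openUnitCube n))).toReal : ℝ) : ℂ)‖ₑ =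
      eLpNorm f ∞ (volume.restrict (openUnitCube n)) := by
    rw [← ofReal_norm, Complex.norm_real, Real.norm_of_nonneg ENNReal.toReal_nonneg,
      ENNReal.ofReal_toReal hf.2.ne]
  rw [h3] at h2
  refine (le_of_eq h2).trans ?_
  rw [mul_comm A]
  gcongr
  exact h _ (hg.indicator (measurableSet_openUnitCube n))

lemma linearExtension_top (n : ℕ) : LinearExtension n ∞ ∞ := by
  refine linearExtension_of_unitBounded (A := volume (closedCube (0 : Freq n) 1))
    (volume_ne_top_of_subset_closedCube subset_rfl) fun f hf => ?_
  rw [eLpNorm_exponent_top]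
  exact eLpNormEssSup_le_of_ae_enorm_bound
    (Filter.Eventually.of_forall fun x => hf.enorm_extOp_le _ x)

/-- The bilinear estimate for functions bounded by one implies the linear extension estimate. -/
lemma linearExtension_of_unitBilinearBound {n : ℕ} {p : ℝ≥0∞} (hp1 : 1 ≤ p) (hpt : p ≠ ∞)
    (hP : 2 * (((n - 1 : ℕ) : ℝ) + 1) < ((n - 1 : ℕ) : ℝ) * p.toReal) {C : ℝ≥0∞}
    (hC : UnitBilinearBound n p.toReal C) (hCt : C ≠ ∞) : LinearExtension n ∞ p := by
  have hP1 : 1 ≤ p.toReal := by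
    simpa using ENNReal.toReal_mono hpt hp1
  obtain ⟨A, hA, h⟩ := exists_bound_of_bilinear hP1 hP hC hCt
  have hp0 : p ≠ 0 := (zero_lt_one.trans_le hp1).ne'
  refine linearExtension_of_unitBounded (A := A ^ (1 / p.toReal)) (by finiteness) fun f hf => ?_
  rw [eLpNorm_eq_lintegral_rpow_enorm_toReal hp0 hpt]
  gcongr
  exact h f hf

/-- The bilinear estimate for a single function gives the one for pairs of functions. -/
lemma BilinearBound.unitBilinearBound {n : ℕ} {p : ℝ≥0∞} (hp0 : p ≠ 0) (hpt : p ≠ ∞) {C : ℝ≥0∞}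
    (h : BilinearBound n ∞ p (1 / 2) C) : UnitBilinearBound n p.toReal (C ^ p.toReal) := by
  classical
  intro Ω₁ Ω₂ h₁ h₂ hs₁ hs₂ hd g₁ g₂ hg₁ hg₂
  have hm₁ : MeasurableSet Ω₁ := by
    obtain ⟨c, r, -, rfl⟩ := h₁; exact measurableSet_closedCube c r
  have hm₂ : MeasurableSet Ω₂ := by
    obtain ⟨c, r, -, rfl⟩ := h₂; exact measurableSet_closedCube c r
  -- Separated cubes are disjoint, so one function can agree with `g₁` on `Ω₁` and with `g₂` on
  -- `Ω₂`.
  set f : Freq n → ℂ := Ω₁.piecewise g₁ g₂ with hf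
  have hfu : UnitBounded f := by
    refine ⟨hg₁.1.piecewise hm₁ hg₂.1, fun ξ => ?_⟩
    by_cases hξ : ξ ∈ Ω₁
    · rw [hf, Set.piecewise_eq_of_mem _ _ _ hξ]; exact hg₁.2 ξ
    · rw [hf, Set.piecewise_eq_of_notMem _ _ _ hξ]; exact hg₂.2 ξ
  have hdisj : ∀ ξ ∈ Ω₂, ξ ∉ Ω₁ := by
    intro ξ hξ2 hξ1
    have : setDist Ω₁ Ω₂ ≤ edist ξ ξ := (iInf₂_le ξ hξ1).trans (iInf₂_le ξ hξ2)
    have h0 := hd.trans this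
    rw [edist_self, nonpos_iff_eq_zero, ENNReal.ofReal_eq_zero] at h0
    norm_num at h0
  have e1 : extOp Ω₁ f = extOp Ω₁ g₁ := extOp_congr_ae <| by
    filter_upwards [ae_restrict_mem hm₁] with ξ hξ
    rw [hf, Set.piecewise_eq_of_mem _ _ _ hξ]
  have e2 : extOp Ω₂ f = extOp Ω₂ g₂ := extOp_congr_ae <| by
    filter_upwards [ae_restrict_mem hm₂] with ξ hξ
    rw [hf, Set.piecewise_eq_of_notMem _ _ _ (hdisj ξ hξ)]
  have hle : ∀ μ : Measure (Freq n), eLpNorm f ∞ μ ≤ 1 := fun μ => by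
    rw [eLpNorm_exponent_top]
    refine eLpNormEssSup_le_of_ae_enorm_bound (Filter.Eventually.of_forall fun ξ => ?_)
    rw [← ofReal_norm]
    exact ENNReal.ofReal_le_one.2 (hfu.2 ξ)
  have key := h Ω₁ Ω₂ h₁ h₂ hs₁ hs₂ hd f
    ⟨hfu.1.aestronglyMeasurable, (hle _).trans_lt ENNReal.one_lt_top⟩
  rw [e1, e2] at key
  have hpp : 0 < p.toReal := ENNReal.toReal_pos hp0 hpt
  have key2 : eLpNorm (fun x : Phys n => ‖extOp Ω₁ g₁ x * extOp Ω₂ g₂ x‖ ^ (1 / 2 : ℝ)) p volume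
      ≤ C := by
    refine key.trans ?_
    calc _ ≤ C * ((1 : ℝ≥0∞) * 1) ^ (1 / 2 : ℝ) := by
          gcongr <;> exact hle _
      _ = C := by simp
  rw [eLpNorm_eq_lintegral_rpow_enorm_toReal hp0 hpt, one_div p.toReal,
    ENNReal.rpow_inv_le_iff hpp] at key2
  refine le_trans (le_of_eq ?_) key2
  congr 1 with x
  rw [Real.enorm_rpow_of_nonneg (norm_nonneg _) (by norm_num), enorm_norm, ← ENNReal.rpow_mul]
  congr 1
  ring

/-- A bilinear restriction estimate implies the linear one for `p > 2n / (n - 1)`. -/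
theorem linearExtension_of_BR_lt_top {n : ℕ} (hn : 2 ≤ n) {p : ℝ≥0∞}
    (hp : ENNReal.ofReal (2 * (n : ℝ) / ((n : ℝ) - 1)) < p) (hpt : p ≠ ∞)
    (h : BR n ∞ p (1 / 2) < ∞) : LinearExtension n ∞ p := by
  obtain ⟨C, hC, hCt⟩ := sInf_lt_iff.1 h
  have hn1 : (1 : ℝ) < n := by exact_mod_cast hn
  have hd : 0 < (n : ℝ) - 1 := by linarith
  have hP := (ENNReal.ofReal_lt_iff_lt_toReal (by positivity) hpt).1 hp
  have hP' : 2 * (n : ℝ) < ((n : ℝ) - 1) * p.toReal := by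
    rw [div_lt_iff₀ hd] at hP; linarith
  have hp1 : 1 ≤ p := by
    refine le_trans ?_ hp.le
    rw [ENNReal.one_le_ofReal, le_div_iff₀ hd]
    linarith
  have hp0 : p ≠ 0 := (zero_lt_one.trans_le hp1).ne'
  refine linearExtension_of_unitBilinearBound hp1 hpt ?_ (hC.unitBilinearBound hp0 hpt)
    (by finiteness)
  rw [Nat.cast_sub (by omega)]
  push_cast
  linarith

/-! ### The bilinear estimate in the plane. -/

lemma norm_integral_gaussian_fourier {V : Type*} [NormedAddCommGroup V] [InnerProductSpace ℝ V]
    [FiniteDimensional ℝ V] [MeasurableSpace V] [BorelSpace V] {ε : ℝ} (hε : 0 < ε) (w : V) :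
    ‖∫ v : V, (Real.exp (-(Real.pi * ε) * ‖v‖ ^ 2) : ℂ) *
        Complex.exp (2 * Real.pi * Complex.I * ((inner ℝ v w : ℝ) : ℂ))‖ =
      (ε⁻¹) ^ (Module.finrank ℝ V / 2 : ℝ) * Real.exp (-(Real.pi / ε) * ‖w‖ ^ 2) := by
  have hb : 0 < ((Real.pi * ε : ℝ) : ℂ).re := by
    rw [Complex.ofReal_re]; positivity
  have h := GaussianFourier.integral_cexp_neg_mul_sq_norm_add hb (2 * Real.pi * Complex.I) w
  have e1 : ∀ v : V, (Real.exp (-(Real.pi * ε) * ‖v‖ ^ 2) : ℂ) *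
        Complex.exp (2 * Real.pi * Complex.I * ((inner ℝ v w : ℝ) : ℂ)) =
      Complex.exp (-((Real.pi * ε : ℝ) : ℂ) * (‖v‖ : ℂ) ^ 2 +
        2 * Real.pi * Complex.I * ((inner ℝ w v : ℝ) : ℂ)) := by
    intro v
    rw [Complex.exp_add, real_inner_comm]
    push_cast
    rfl
  simp only [e1]
  rw [h, norm_mul]
  have hpi : (Real.pi : ℂ) / ((Real.pi * ε : ℝ) : ℂ) = ((ε⁻¹ : ℝ) : ℂ) := by
    have : (Real.pi : ℂ) ≠ 0 := by exact_mod_cast Real.pi_ne_zero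
    have : (ε : ℂ) ≠ 0 := by exact_mod_cast hε.ne'
    push_cast
    field_simp
  have hexp : (2 * Real.pi * Complex.I) ^ 2 * (‖w‖ : ℂ) ^ 2 / (4 * ((Real.pi * ε : ℝ) : ℂ)) =
      ((-(Real.pi / ε) * ‖w‖ ^ 2 : ℝ) : ℂ) := by
    have : (Real.pi : ℂ) ≠ 0 := by exact_mod_cast Real.pi_ne_zero
    have : (ε : ℂ) ≠ 0 := by exact_mod_cast hε.ne'
    push_cast
    rw [mul_pow, mul_pow, Complex.I_sq]
    field_simp
    ring
  rw [hpi, hexp, ← Complex.ofReal_exp, Complex.norm_real, Real.norm_of_nonneg (Real.exp_pos _).le,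
    Complex.norm_cpow_eq_rpow_re_of_pos (inv_pos.2 hε)]
  congr 2
  simp

lemma integrable_gaussian_norm {V : Type*} [NormedAddCommGroup V] [InnerProductSpace ℝ V]
    [FiniteDimensional ℝ V] [MeasurableSpace V] [BorelSpace V] {b : ℝ} (hb : 0 < b) :
    Integrable fun v : V => Real.exp (-b * ‖v‖ ^ 2) := by
  have h := (GaussianFourier.integrable_cexp_neg_mul_sq_norm_add (b := (b : ℂ))
    (by simpa using hb) 0 (0 : V)).norm
  refine h.congr (Filter.Eventually.of_forall fun v => ?_)
  have : -(b : ℂ) * (‖v‖ : ℂ) ^ 2 + 0 * ((inner ℝ (0 : V) v : ℝ) : ℂ) =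
      ((-b * ‖v‖ ^ 2 : ℝ) : ℂ) := by
    push_cast; ring
  simp only [this, ← Complex.ofReal_exp, Complex.norm_real]
  exact Real.norm_of_nonneg (Real.exp_pos _).le

/-- A weighted `L^2` bound for the Fourier transform of the image of a measure `F ν` under the map
`(φ, ψ)`, in terms of the interaction of nearby points of the image. -/
lemma integral_gaussian_mul_norm_sq_le {V S : Type*} [NormedAddCommGroup V]
    [InnerProductSpace ℝ V] [FiniteDimensional ℝ V] [MeasurableSpace V] [BorelSpace V]
    [MeasurableSpace S] (ν : Measure S) [IsFiniteMeasure ν] {F : S → ℂ} (hF : Measurable F)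
    (hF1 : ∀ s, ‖F s‖ ≤ 1) {φ : S → V} (hφ : Measurable φ) {ψ : S → ℝ} (hψ : Measurable ψ)
    {ε : ℝ} (hε : 0 < ε) :
    ∫ x : V × ℝ, Real.exp (-(Real.pi * ε) * ‖x.1‖ ^ 2) * Real.exp (-(Real.pi * ε) * ‖x.2‖ ^ 2) *
      ‖∫ s, F s * Complex.exp (2 * Real.pi * Complex.I *
        ((inner ℝ x.1 (φ s) + x.2 * ψ s : ℝ) : ℂ)) ∂ν‖ ^ 2 ≤
    ∫ q : S × S, (ε⁻¹) ^ (Module.finrank ℝ V / 2 : ℝ) *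
        Real.exp (-(Real.pi / ε) * ‖φ q.1 - φ q.2‖ ^ 2) *
        ((ε⁻¹) ^ (1 / 2 : ℝ) * Real.exp (-(Real.pi / ε) * ‖ψ q.1 - ψ q.2‖ ^ 2)) ∂(ν.prod ν) := by
  set W₁ : V → ℝ := fun v => Real.exp (-(Real.pi * ε) * ‖v‖ ^ 2) with hW₁
  set W₂ : ℝ → ℝ := fun v => Real.exp (-(Real.pi * ε) * ‖v‖ ^ 2) with hW₂
  have hb : 0 < Real.pi * ε := by positivity
  have hi₁ : Integrable W₁ := integrable_gaussian_norm hb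
  have hi₂ : Integrable W₂ := integrable_gaussian_norm hb
  set e : V × ℝ → S → ℂ := fun x s => Complex.exp (2 * Real.pi * Complex.I *
        ((inner ℝ x.1 (φ s) + x.2 * ψ s : ℝ) : ℂ)) with he
  have hen : ∀ x s, ‖e x s‖ = 1 := fun x s => norm_cexp_two_pi_I_mul _
  -- The square is expanded as a double integral over `S × S`. The Gaussian weight makes the
  -- integrand absolutely integrable, so the physical integral may be done first.
  set J : V × ℝ → S × S → ℂ := fun x q => ((W₁ x.1 * W₂ x.2 : ℝ) : ℂ) *
    ((F q.1 * e x q.1) * (starRingEnd ℂ) (F q.2 * e x q.2)) with hJ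
  have hJn : ∀ x q, ‖J x q‖ ≤ W₁ x.1 * W₂ x.2 := by
    intro x q
    simp only [hJ, norm_mul, RCLike.norm_conj, hen, mul_one, Complex.norm_real]
    rw [Real.norm_of_nonneg (by positivity), Real.norm_of_nonneg (by positivity)]
    have h1 := hF1 q.1
    have h2 := hF1 q.2
    have : ‖F q.1‖ * ‖F q.2‖ ≤ 1 := mul_le_one₀ h1 (norm_nonneg _) h2
    exact mul_le_of_le_one_right (by positivity) this
  have hJm : Measurable (Function.uncurry J) := by
    have hem : Measurable (Function.uncurry e) := by
      simp only [he, Function.uncurry_def]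
      fun_prop
    have hem1 : Measurable fun z : (V × ℝ) × (S × S) => e z.1 z.2.1 :=
      hem.comp (measurable_fst.prodMk measurable_snd.fst)
    have hem2 : Measurable fun z : (V × ℝ) × (S × S) => e z.1 z.2.2 :=
      hem.comp (measurable_fst.prodMk measurable_snd.snd)
    have hc : Measurable (starRingEnd ℂ) := Complex.continuous_conj.measurable
    have m1 : Measurable fun z : (V × ℝ) × (S × S) => F z.2.1 * e z.1 z.2.1 := by fun_prop
    have m2 : Measurable fun z : (V × ℝ) × (S × S) => F z.2.2 * e z.1 z.2.2 := by fun_prop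
    have m3 : Measurable fun z : (V × ℝ) × (S × S) => ((W₁ z.1.1 * W₂ z.1.2 : ℝ) : ℂ) := by
      simp only [hW₁, hW₂]; fun_prop
    exact m3.mul (m1.mul (hc.comp m2))
  have hJi : Integrable (Function.uncurry J) ((volume : Measure (V × ℝ)).prod (ν.prod ν)) := by
    have hdom : Integrable (fun z : (V × ℝ) × (S × S) => (W₁ z.1.1 * W₂ z.1.2) * (1 : ℝ))
        ((volume : Measure (V × ℝ)).prod (ν.prod ν)) :=
      (hi₁.mul_prod hi₂).mul_prod (integrable_const (1 : ℝ))
    refine hdom.mono' hJm.aestronglyMeasurable (Filter.Eventually.of_forall fun z => ?_)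
    rw [mul_one]
    exact hJn z.1 z.2
  have hsq : ∀ x : V × ℝ, ((W₁ x.1 * W₂ x.2 * ‖∫ s, F s * e x s ∂ν‖ ^ 2 : ℝ) : ℂ) =
      ∫ q, J x q ∂(ν.prod ν) := by
    intro x
    simp only [hJ]
    rw [integral_const_mul, integral_prod_mul (fun s => F s * e x s)
      (fun s => (starRingEnd ℂ) (F s * e x s)), integral_conj, Complex.mul_conj,
      Complex.normSq_eq_norm_sq]
    push_cast
    rfl
  have hinner : ∀ q : S × S, ‖∫ x, J x q‖ ≤ (ε⁻¹) ^ (Module.finrank ℝ V / 2 : ℝ) *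
        Real.exp (-(Real.pi / ε) * ‖φ q.1 - φ q.2‖ ^ 2) *
        ((ε⁻¹) ^ (1 / 2 : ℝ) * Real.exp (-(Real.pi / ε) * ‖ψ q.1 - ψ q.2‖ ^ 2)) := by
    intro q
    -- The phase depends only on differences of image points and splits into a space factor and a
    -- time factor, each a Gaussian Fourier transform.
    have h1 : ∀ x : V × ℝ, J x q = (F q.1 * (starRingEnd ℂ) (F q.2)) *
        (((W₁ x.1 : ℂ) * Complex.exp (2 * Real.pi * Complex.I *
          ((inner ℝ x.1 (φ q.1 - φ q.2) : ℝ) : ℂ))) *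
        ((W₂ x.2 : ℂ) * Complex.exp (2 * Real.pi * Complex.I *
          ((inner ℝ x.2 (ψ q.1 - ψ q.2) : ℝ) : ℂ)))) := by
      intro x
      have hconj : (starRingEnd ℂ) (e x q.2) = Complex.exp (-(2 * Real.pi * Complex.I *
        ((inner ℝ x.1 (φ q.2) + x.2 * ψ q.2 : ℝ) : ℂ))) := by
        simp only [he]
        rw [← Complex.exp_conj]
        congr 1
        simp only [map_mul, Complex.conj_ofReal, Complex.conj_I, map_ofNat]
        ring
      have he1 : e x q.1 = Complex.exp (2 * Real.pi * Complex.I *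
        ((inner ℝ x.1 (φ q.1) + x.2 * ψ q.1 : ℝ) : ℂ)) := rfl
      have hee : e x q.1 * (starRingEnd ℂ) (e x q.2) = Complex.exp (2 * Real.pi * Complex.I *
          ((inner ℝ x.1 (φ q.1 - φ q.2) : ℝ) : ℂ)) * Complex.exp (2 * Real.pi * Complex.I *
          ((inner ℝ x.2 (ψ q.1 - ψ q.2) : ℝ) : ℂ)) := by
        have hin : ∀ a b : ℝ, inner ℝ a b = a * b := fun a b => by simp [mul_comm]
        rw [hconj, he1, ← Complex.exp_add, ← Complex.exp_add]
        congr 1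
        simp only [inner_sub_right, hin]
        push_cast
        ring
      simp only [hJ, map_mul]
      calc _ = (F q.1 * (starRingEnd ℂ) (F q.2)) * ((W₁ x.1 * W₂ x.2 : ℝ) : ℂ) *
            (e x q.1 * (starRingEnd ℂ) (e x q.2)) := by ring
        _ = _ := by rw [hee]; push_cast; ring
    have n1 := norm_integral_gaussian_fourier hε (φ q.1 - φ q.2)
    have n2 := norm_integral_gaussian_fourier hε (ψ q.1 - ψ q.2)
    rw [Module.finrank_self, Nat.cast_one] at n2
    simp only [h1]
    rw [integral_const_mul, Measure.volume_eq_prod, integral_prod_mul (fun v : V => (W₁ v : ℂ) *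
      Complex.exp (2 * Real.pi * Complex.I * ((inner ℝ v (φ q.1 - φ q.2) : ℝ) : ℂ)))
      (fun t : ℝ => (W₂ t : ℂ) * Complex.exp (2 * Real.pi * Complex.I *
          ((inner ℝ t (ψ q.1 - ψ q.2) : ℝ) : ℂ))), norm_mul, norm_mul,
      norm_mul, RCLike.norm_conj, ← n1, ← n2]
    have : ‖F q.1‖ * ‖F q.2‖ ≤ 1 := mul_le_one₀ (hF1 _) (norm_nonneg _) (hF1 _)
    exact mul_le_of_le_one_left (by positivity) this
  have hreal : ((∫ x : V × ℝ, W₁ x.1 * W₂ x.2 * ‖∫ s, F s * e x s ∂ν‖ ^ 2 : ℝ) : ℂ) =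
      ∫ q, ∫ x, J x q ∂(volume : Measure (V × ℝ)) ∂(ν.prod ν) := by
    rw [← integral_integral_swap hJi, ← integral_complex_ofReal]
    congr 1 with x
    exact hsq x
  have hnn : 0 ≤ ∫ x : V × ℝ, W₁ x.1 * W₂ x.2 * ‖∫ s, F s * e x s ∂ν‖ ^ 2 :=
    integral_nonneg fun x => by positivity
  calc ∫ x : V × ℝ, W₁ x.1 * W₂ x.2 * ‖∫ s, F s * e x s ∂ν‖ ^ 2
      = ‖((∫ x : V × ℝ, W₁ x.1 * W₂ x.2 * ‖∫ s, F s * e x s ∂ν‖ ^ 2 : ℝ) : ℂ)‖ := by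
        rw [Complex.norm_real, Real.norm_of_nonneg hnn]
    _ = ‖∫ q, ∫ x, J x q ∂(volume : Measure (V × ℝ)) ∂(ν.prod ν)‖ := by rw [hreal]
    _ ≤ _ := by
        refine norm_integral_le_of_norm_le ?_ (Filter.Eventually.of_forall hinner)
        refine Integrable.of_bound (C := (ε⁻¹) ^ (Module.finrank ℝ V / 2 : ℝ) *
          (ε⁻¹) ^ (1 / 2 : ℝ)) (by fun_prop) (Filter.Eventually.of_forall fun q => ?_)
        rw [Real.norm_of_nonneg (by positivity)]
        have h1 : Real.exp (-(Real.pi / ε) * ‖φ q.1 - φ q.2‖ ^ 2) ≤ 1 := by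
          rw [Real.exp_le_one_iff, neg_mul, neg_nonpos]; positivity
        have h2 : Real.exp (-(Real.pi / ε) * ‖ψ q.1 - ψ q.2‖ ^ 2) ≤ 1 := by
          rw [Real.exp_le_one_iff, neg_mul, neg_nonpos]; positivity
        have hi : 0 < ε⁻¹ := inv_pos.2 hε
        exact mul_le_mul (mul_le_of_le_one_right (by positivity) h1)
          (mul_le_of_le_one_right (by positivity) h2) (by positivity) (by positivity)

/-- The map `(ξ, η) ↦ (ξ + η, ξ² + η²)` is bi-Lipschitz away from the diagonal. -/
lemma sq_add_sq_le_of_separated {a b α β : ℝ} (hα : |α| ≤ 2) (hβ : |β| ≤ 2) (h : 1 ≤ |β - α|) :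
    a ^ 2 + b ^ 2 ≤ 10 * ((a + b) ^ 2 + (a * α + b * β) ^ 2) := by
  -- With `u = a + b` and `v = aα + bβ`, one has `v - αu = b(β - α)` and `v - βu = -a(β - α)`.
  -- Cauchy–Schwarz with `1 + r² ≤ 5` bounds each square, and the two add up to the factor `10`.
  have key : ∀ u v r : ℝ, |r| ≤ 2 → (v - r * u) ^ 2 ≤ 5 * (u ^ 2 + v ^ 2) := by
    intro u v r hr
    have hr2 : r ^ 2 ≤ 4 := by
      have := sq_le_sq' (abs_le.1 hr).1 (abs_le.1 hr).2; linarith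
    nlinarith [sq_nonneg (u + r * v), mul_nonneg (sub_nonneg.2 hr2) (sq_nonneg v),
      mul_nonneg (sub_nonneg.2 hr2) (sq_nonneg u)]
  have hd : 1 ≤ (β - α) ^ 2 := by
    rw [← sq_abs]; nlinarith
  have h1 := key (a + b) (a * α + b * β) α hα
  have h2 := key (a + b) (a * α + b * β) β hβ
  have e1 : a * α + b * β - α * (a + b) = b * (β - α) := by ring
  have e2 : a * α + b * β - β * (a + b) = -(a * (β - α)) := by ring
  rw [e1] at h1
  rw [e2] at h2
  nlinarith [mul_nonneg (sub_nonneg.2 hd) (sq_nonneg a), mul_nonneg (sub_nonneg.2 hd) (sq_nonneg b)]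

lemma norm_freq_two (ξ : Freq 2) : ‖ξ‖ = |ξ 0| := by
  rw [EuclideanSpace.norm_eq]
  simp [Real.sqrt_sq_eq_abs]

/-- Separated intervals keep their order. -/
lemma separated_intervals {Ω₁ Ω₂ : Set (Freq 2)} (h₁ : IsCube Ω₁) (h₂ : IsCube Ω₂)
    (hd : ENNReal.ofReal (1 / 2) ≤ setDist Ω₁ Ω₂) :
    (∀ ξ ∈ Ω₁, ∀ η ∈ Ω₂, 1 / 2 ≤ η 0 - ξ 0) ∨ (∀ ξ ∈ Ω₁, ∀ η ∈ Ω₂, 1 / 2 ≤ ξ 0 - η 0) := by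
  have hdist : ∀ ξ ∈ Ω₁, ∀ η ∈ Ω₂, 1 / 2 ≤ |ξ 0 - η 0| := by
    intro ξ hξ η hη
    have : setDist Ω₁ Ω₂ ≤ edist ξ η := (iInf₂_le ξ hξ).trans (iInf₂_le η hη)
    have h := hd.trans this
    rw [edist_dist, ENNReal.ofReal_le_ofReal_iff dist_nonneg, dist_eq_norm, norm_freq_two] at h
    simpa using h
  obtain ⟨c₁, r₁, hr₁, rfl⟩ := h₁
  obtain ⟨c₂, r₂, hr₂, rfl⟩ := h₂
  have hmem : ∀ (c : Freq 2) (r s : ℝ), |s - c 0| ≤ r →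
      (WithLp.toLp 2 fun _ => s : Freq 2) ∈ closedCube c r := by
    intro c r s hs j
    rw [Subsingleton.elim (α := Fin 1) j 0]
    exact hs
  have hpt : ∀ s t : ℝ, |s - c₁ 0| ≤ r₁ → |t - c₂ 0| ≤ r₂ → 1 / 2 ≤ |s - t| := by
    intro s t hs ht
    simpa using hdist _ (hmem c₁ r₁ s hs) _ (hmem c₂ r₂ t ht)
  -- Overlapping intervals share the larger of their left endpoints, contradicting the positive
  -- distance.
  have hov : ¬ (c₁ 0 - r₁ ≤ c₂ 0 + r₂ ∧ c₂ 0 - r₂ ≤ c₁ 0 + r₁) := by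
    rintro ⟨ha, hb⟩
    set s := max (c₁ 0 - r₁) (c₂ 0 - r₂) with hs
    have h1 : c₁ 0 - r₁ ≤ s := le_max_left _ _
    have h2 : c₂ 0 - r₂ ≤ s := le_max_right _ _
    have h3 : s ≤ c₁ 0 + r₁ := max_le (by linarith) hb
    have h4 : s ≤ c₂ 0 + r₂ := max_le ha (by linarith)
    have := hpt s s (abs_le.2 ⟨by linarith, by linarith⟩) (abs_le.2 ⟨by linarith, by linarith⟩)
    norm_num at this
  by_cases hb : c₂ 0 - r₂ ≤ c₁ 0 + r₁
  · right
    have ha : c₂ 0 + r₂ < c₁ 0 - r₁ := not_le.1 fun h => hov ⟨h, hb⟩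
    intro ξ hξ η hη
    have h1 := abs_le.1 (hξ 0)
    have h2 := abs_le.1 (hη 0)
    have h3 := hdist ξ hξ η hη
    rwa [abs_of_nonneg (by linarith [h1.1, h2.2])] at h3
  · left
    intro ξ hξ η hη
    have h1 := abs_le.1 (hξ 0)
    have h2 := abs_le.1 (hη 0)
    have h3 := hdist ξ hξ η hη
    rwa [abs_sub_comm, abs_of_nonneg (by linarith [h1.2, h2.1])] at h3

lemma integral_gaussian_freq_two {b : ℝ} (hb : 0 < b) :
    ∫ v : Freq 2, Real.exp (-b * ‖v‖ ^ 2) = (Real.pi / b) ^ (1 / 2 : ℝ) := by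
  rw [GaussianFourier.integral_rexp_neg_mul_sq_norm hb]
  simp

/-- Each Gaussian factor has mass `(10ε)^(1/2)`. The resulting `10ε` cancels the `ε⁻¹` of the
Fourier side, which makes the weighted bound uniform in `ε`. -/
lemma integral_gaussian_prod_le {Ω₁ Ω₂ : Set (Freq 2)} {ε : ℝ} (hε : 0 < ε)
    (z : Freq 2 × Freq 2) :
    ∫ s, Real.exp (-(Real.pi / (10 * ε)) * ‖z.1 - s.1‖ ^ 2) *
      Real.exp (-(Real.pi / (10 * ε)) * ‖z.2 - s.2‖ ^ 2)
        ∂((volume.restrict Ω₁).prod (volume.restrict Ω₂)) ≤ 10 * ε := by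
  have hb : 0 < Real.pi / (10 * ε) := by positivity
  have hone : ∀ (Ω : Set (Freq 2)) (y : Freq 2),
      ∫ v in Ω, Real.exp (-(Real.pi / (10 * ε)) * ‖y - v‖ ^ 2) ≤ (10 * ε) ^ (1 / 2 : ℝ) := by
    intro Ω y
    have hi : Integrable fun v : Freq 2 => Real.exp (-(Real.pi / (10 * ε)) * ‖y - v‖ ^ 2) :=
      (integrable_gaussian_norm hb).comp_sub_left y
    refine (setIntegral_le_integral hi (Filter.Eventually.of_forall fun v =>
      (Real.exp_pos _).le)).trans (le_of_eq ?_)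
    rw [integral_sub_left_eq_self (fun v : Freq 2 => Real.exp (-(Real.pi / (10 * ε)) * ‖v‖ ^ 2)),
      integral_gaussian_freq_two hb]
    congr 1
    field_simp
  rw [integral_prod_mul (fun s : Freq 2 => Real.exp (-(Real.pi / (10 * ε)) * ‖z.1 - s‖ ^ 2))
    (fun s : Freq 2 => Real.exp (-(Real.pi / (10 * ε)) * ‖z.2 - s‖ ^ 2))]
  calc _ ≤ (10 * ε) ^ (1 / 2 : ℝ) * (10 * ε) ^ (1 / 2 : ℝ) :=
        mul_le_mul (hone _ _) (hone _ _) (integral_nonneg fun _ => (Real.exp_pos _).le)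
          (by positivity)
    _ = 10 * ε := by
        rw [← Real.rpow_add (by positivity)]; norm_num

/-- This puts the product into the form treated by `integral_gaussian_mul_norm_sq_le`, with `φ` the
sum of the frequencies and `ψ` the sum of their squared norms. -/
lemma extOp_mul_extOp {n : ℕ} (Ω₁ Ω₂ : Set (Freq n)) (g₁ g₂ : Freq n → ℂ) (x : Phys n) :
    extOp Ω₁ g₁ x * extOp Ω₂ g₂ x =
      ∫ s, (g₁ s.1 * g₂ s.2) * Complex.exp (2 * Real.pi * Complex.I *
        ((inner ℝ x.1 (s.1 + s.2) + x.2 * (‖s.1‖ ^ 2 + ‖s.2‖ ^ 2) : ℝ) : ℂ))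
        ∂((volume.restrict Ω₁).prod (volume.restrict Ω₂)) := by
  unfold extOp
  rw [← integral_prod_mul]
  congr 1 with s
  rw [mul_mul_mul_comm, ← Complex.exp_add]
  congr 2
  rw [inner_add_right]
  push_cast
  ring

/-- The bilinear `L^2` estimate over separated intervals, with a Gaussian weight. -/
lemma integral_gaussian_mul_norm_sq_extOp_le {Ω₁ Ω₂ : Set (Freq 2)} (h₁ : IsCube Ω₁)
    (h₂ : IsCube Ω₂) (hs₁ : Ω₁ ⊆ closedCube 0 1) (hs₂ : Ω₂ ⊆ closedCube 0 1)
    (hd : ENNReal.ofReal (1 / 2) ≤ setDist Ω₁ Ω₂) {g₁ g₂ : Freq 2 → ℂ} (hg₁ : UnitBounded g₁)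
    (hg₂ : UnitBounded g₂) {ε : ℝ} (hε : 0 < ε) :
    ∫ x : Phys 2, Real.exp (-(Real.pi * ε) * ‖x.1‖ ^ 2) * Real.exp (-(Real.pi * ε) * ‖x.2‖ ^ 2) *
      ‖extOp Ω₁ g₁ x * extOp Ω₂ g₂ x‖ ^ 2 ≤
      10 * (volume (closedCube (0 : Freq 2) 1)).toReal ^ 2 := by
  have hm₁ : MeasurableSet Ω₁ := by
    obtain ⟨c, r, -, rfl⟩ := h₁; exact measurableSet_closedCube c r
  have hm₂ : MeasurableSet Ω₂ := by
    obtain ⟨c, r, -, rfl⟩ := h₂; exact measurableSet_closedCube c r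
  have hvt : volume (closedCube (0 : Freq 2) 1) ≠ ∞ :=
    volume_ne_top_of_subset_closedCube subset_rfl
  have : IsFiniteMeasure (volume.restrict Ω₁) :=
    ⟨by simpa using (volume_ne_top_of_subset_closedCube hs₁).lt_top⟩
  have : IsFiniteMeasure (volume.restrict Ω₂) :=
    ⟨by simpa using (volume_ne_top_of_subset_closedCube hs₂).lt_top⟩
  set ν := (volume.restrict Ω₁).prod (volume.restrict Ω₂) with hν
  have hνle : ν.real Set.univ ≤ (volume (closedCube (0 : Freq 2) 1)).toReal ^ 2 := by
    have : ν Set.univ = volume Ω₁ * volume Ω₂ := by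
      rw [hν, ← Set.univ_prod_univ, Measure.prod_prod]; simp
    rw [Measure.real, this, ENNReal.toReal_mul, sq]
    gcongr
  have hsep : ∀ s ∈ Ω₁ ×ˢ Ω₂, ∀ s' ∈ Ω₁ ×ˢ Ω₂, ‖s.1 - s'.1‖ ^ 2 + ‖s.2 - s'.2‖ ^ 2 ≤
      10 * (‖(s.1 + s.2) - (s'.1 + s'.2)‖ ^ 2 +
        ‖(‖s.1‖ ^ 2 + ‖s.2‖ ^ 2) - (‖s'.1‖ ^ 2 + ‖s'.2‖ ^ 2)‖ ^ 2) := by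
    rintro ⟨ξ, η⟩ ⟨hξ, hη⟩ ⟨ξ', η'⟩ ⟨hξ', hη'⟩
    simp only [norm_freq_two, sq_abs, PiLp.sub_apply, PiLp.add_apply, Real.norm_eq_abs]
    have hbd : ∀ Ω : Set (Freq 2), Ω ⊆ closedCube 0 1 → ∀ ζ ∈ Ω, |ζ 0| ≤ 1 := by
      intro Ω hΩ ζ hζ
      simpa using hΩ hζ 0
    have b1 := hbd _ hs₁ ξ hξ
    have b2 := hbd _ hs₁ ξ' hξ'
    have b3 := hbd _ hs₂ η hη
    have b4 := hbd _ hs₂ η' hη'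
    have hα : |ξ 0 + ξ' 0| ≤ 2 := (abs_add_le _ _).trans (by linarith)
    have hβ : |η 0 + η' 0| ≤ 2 := (abs_add_le _ _).trans (by linarith)
    -- The intervals keep their order, so the two gaps of at least `1/2` have the same sign and add
    -- up to `1`.
    have hαβ : 1 ≤ |(η 0 + η' 0) - (ξ 0 + ξ' 0)| := by
      rcases separated_intervals h₁ h₂ hd with h | h
      · refine le_trans ?_ (le_abs_self _)
        linarith [h ξ hξ η hη, h ξ' hξ' η' hη']
      · refine le_trans ?_ (neg_le_abs _)
        linarith [h ξ hξ η hη, h ξ' hξ' η' hη']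
    -- Here `α` and `β` are sums, so that `a * α = ξ² - ξ'²` and `b * β = η² - η'²`.
    have key := sq_add_sq_le_of_separated (a := ξ 0 - ξ' 0) (b := η 0 - η' 0) hα hβ hαβ
    refine key.trans (le_of_eq ?_)
    ring
  have hae : ∀ᵐ s ∂ν, s ∈ Ω₁ ×ˢ Ω₂ := by
    rw [hν, Measure.prod_restrict]
    exact ae_restrict_mem (hm₁.prod hm₂)
  have hmeas : Measurable fun s : Freq 2 × Freq 2 => g₁ s.1 * g₂ s.2 :=
    (hg₁.1.comp measurable_fst).mul (hg₂.1.comp measurable_snd)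
  have main := integral_gaussian_mul_norm_sq_le ν hmeas
    (fun s => by
      rw [norm_mul]; exact mul_le_one₀ (hg₁.2 _) (norm_nonneg _) (hg₂.2 _))
    (φ := fun s => s.1 + s.2) (by fun_prop) (ψ := fun s => ‖s.1‖ ^ 2 + ‖s.2‖ ^ 2) (by fun_prop) hε
  simp only [extOp_mul_extOp]
  refine main.trans ?_
  have hconst : (ε⁻¹) ^ (Module.finrank ℝ (Freq 2) / 2 : ℝ) * (ε⁻¹) ^ (1 / 2 : ℝ) = ε⁻¹ := by
    rw [finrank_euclideanSpace, Fintype.card_fin, ← Real.rpow_add (inv_pos.2 hε)]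
    norm_num
  set G : (Freq 2 × Freq 2) × (Freq 2 × Freq 2) → ℝ := fun q =>
    ε⁻¹ * (Real.exp (-(Real.pi / (10 * ε)) * ‖q.1.1 - q.2.1‖ ^ 2) *
      Real.exp (-(Real.pi / (10 * ε)) * ‖q.1.2 - q.2.2‖ ^ 2)) with hG
  have hGi : Integrable G (ν.prod ν) := by
    refine Integrable.of_bound (C := ε⁻¹) (by fun_prop) (Filter.Eventually.of_forall fun q => ?_)
    rw [Real.norm_of_nonneg (by positivity)]
    refine mul_le_of_le_one_right (by positivity) (mul_le_one₀ ?_ (Real.exp_pos _).le ?_) <;>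
    · rw [Real.exp_le_one_iff, neg_mul, neg_nonpos]; positivity
  calc _ ≤ ∫ q, G q ∂(ν.prod ν) := by
        refine integral_mono_of_nonneg (Filter.Eventually.of_forall fun q => by positivity) hGi ?_
        have ha1 : ∀ᵐ q ∂(ν.prod ν), q.1 ∈ Ω₁ ×ˢ Ω₂ := Measure.quasiMeasurePreserving_fst.ae hae
        have ha2 : ∀ᵐ q ∂(ν.prod ν), q.2 ∈ Ω₁ ×ˢ Ω₂ := Measure.quasiMeasurePreserving_snd.ae hae
        filter_upwards [ha1, ha2] with q hq1 hq2
        have h := hsep q.1 hq1 q.2 hq2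
        rw [mul_mul_mul_comm, hconst]
        simp only [hG]
        rw [← Real.exp_add, ← Real.exp_add]
        gcongr ?_ * Real.exp ?_
        have hpe : 0 ≤ Real.pi / (10 * ε) := by positivity
        have h' := mul_le_mul_of_nonneg_left h hpe
        have e : Real.pi / ε = 10 * (Real.pi / (10 * ε)) := by field_simp
        rw [e]
        linarith
    _ = ∫ s, ∫ s', G (s, s') ∂ν ∂ν := integral_prod _ hGi
    _ ≤ ∫ _s, (10 : ℝ) ∂ν := by
        refine integral_mono_of_nonneg (Filter.Eventually.of_forall fun s =>
          integral_nonneg fun s' => by positivity) (integrable_const _)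
          (Filter.Eventually.of_forall fun s => ?_)
        simp only [hG]
        rw [integral_const_mul]
        calc _ ≤ ε⁻¹ * (10 * ε) := by
              gcongr
              exact integral_gaussian_prod_le hε s
          _ = 10 := by field_simp
    _ = 10 * ν.real Set.univ := by simp [mul_comm]
    _ ≤ _ := by gcongr

/-- The weighted bound does not depend on `ε`, so the weight can be flattened: on each ball `ε` is
chosen to keep it above `exp (-2π)`, and the balls exhaust the plane. -/
lemma lintegral_enorm_sq_extOp_mul_le {Ω₁ Ω₂ : Set (Freq 2)} (h₁ : IsCube Ω₁)
    (h₂ : IsCube Ω₂) (hs₁ : Ω₁ ⊆ closedCube 0 1) (hs₂ : Ω₂ ⊆ closedCube 0 1)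
    (hd : ENNReal.ofReal (1 / 2) ≤ setDist Ω₁ Ω₂) {g₁ g₂ : Freq 2 → ℂ} (hg₁ : UnitBounded g₁)
    (hg₂ : UnitBounded g₂) :
    ∫⁻ x : Phys 2, ‖extOp Ω₁ g₁ x * extOp Ω₂ g₂ x‖ₑ ^ (2 : ℝ) ≤
      ENNReal.ofReal (Real.exp (2 * Real.pi) *
        (10 * (volume (closedCube (0 : Freq 2) 1)).toReal ^ 2)) := by
  set H : Phys 2 → ℂ := fun x => extOp Ω₁ g₁ x * extOp Ω₂ g₂ x with hH
  have hv₁ := volume_ne_top_of_subset_closedCube hs₁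
  have hv₂ := volume_ne_top_of_subset_closedCube hs₂
  have hHc : Continuous H := (hg₁.continuous_extOp hv₁).mul (hg₂.continuous_extOp hv₂)
  have hHb : ∀ x, ‖H x‖ ≤ (volume Ω₁).toReal * (volume Ω₂).toReal := by
    intro x
    rw [hH, norm_mul, ← toReal_enorm, ← toReal_enorm]
    gcongr
    · exact hg₁.enorm_extOp_le _ x
    · exact hg₂.enorm_extOp_le _ x
  have hmono : Monotone fun N : ℕ => Metric.closedBall (0 : Phys 2) N :=
    fun a b hab => Metric.closedBall_subset_closedBall (by exact_mod_cast hab)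
  rw [← setLIntegral_univ, ← Metric.iUnion_closedBall_nat (0 : Phys 2),
    setLIntegral_iUnion_of_directed _ hmono.directed_le]
  refine iSup_le fun N => ?_
  -- On the ball of radius `N` this gives `ε‖x.1‖² ≤ 1` and `ε‖x.2‖² ≤ 1`; the `+ 1` keeps `ε`
  -- defined for `N = 0`.
  set ε : ℝ := 1 / ((N : ℝ) + 1) ^ 2 with hεdef
  have hε : 0 < ε := by positivity
  have hb : 0 < Real.pi * ε := by positivity
  set w : Phys 2 → ℝ := fun x => Real.exp (-(Real.pi * ε) * ‖x.1‖ ^ 2) *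
    Real.exp (-(Real.pi * ε) * ‖x.2‖ ^ 2) with hw
  have hwi : Integrable w := (integrable_gaussian_norm hb).mul_prod (integrable_gaussian_norm hb)
  have hwH : Integrable fun x => w x * ‖H x‖ ^ 2 := by
    refine hwi.mul_bdd (c := ((volume Ω₁).toReal * (volume Ω₂).toReal) ^ 2)
      (hHc.norm.pow 2).aestronglyMeasurable (Filter.Eventually.of_forall fun x => ?_)
    rw [norm_pow, norm_norm]
    gcongr
    exact hHb x
  have hwlow : ∀ x ∈ Metric.closedBall (0 : Phys 2) N, 1 ≤ Real.exp (2 * Real.pi) * w x := by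
    intro x hx
    have hx' : ‖x.1‖ ≤ N ∧ ‖x.2‖ ≤ N := by simpa [Prod.norm_def] using hx
    have hbd : ∀ r : ℝ, 0 ≤ r → r ≤ N → ε * r ^ 2 ≤ 1 := by
      intro r h0 hr
      rw [hεdef, one_div, inv_mul_le_iff₀ (by positivity), mul_one]
      gcongr
      linarith
    simp only [hw]
    rw [← Real.exp_add, ← Real.exp_add, Real.one_le_exp_iff]
    have i1 := hbd _ (norm_nonneg _) hx'.1
    have i2 := hbd _ (norm_nonneg _) hx'.2
    nlinarith [Real.pi_pos]
  calc ∫⁻ x in Metric.closedBall (0 : Phys 2) N, ‖H x‖ₑ ^ (2 : ℝ)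
      ≤ ∫⁻ x in Metric.closedBall (0 : Phys 2) N,
          ENNReal.ofReal (Real.exp (2 * Real.pi)) * ENNReal.ofReal (w x * ‖H x‖ ^ 2) := by
        refine setLIntegral_mono' Metric.isClosed_closedBall.measurableSet fun x hx => ?_
        rw [← ENNReal.ofReal_mul (Real.exp_pos _).le, ← ofReal_norm,
          ENNReal.ofReal_rpow_of_nonneg (norm_nonneg _) zero_le_two, Real.rpow_two]
        refine ENNReal.ofReal_le_ofReal ?_
        rw [← mul_assoc]
        exact le_mul_of_one_le_left (by positivity) (hwlow x hx)
    _ ≤ ∫⁻ x, ENNReal.ofReal (Real.exp (2 * Real.pi)) * ENNReal.ofReal (w x * ‖H x‖ ^ 2) :=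
        setLIntegral_le_lintegral _ _
    _ = ENNReal.ofReal (Real.exp (2 * Real.pi) * ∫ x, w x * ‖H x‖ ^ 2) := by
        rw [lintegral_const_mul' _ _ ENNReal.ofReal_ne_top,
          ← ofReal_integral_eq_lintegral_ofReal hwH
            (Filter.Eventually.of_forall fun x => by positivity),
          ← ENNReal.ofReal_mul (Real.exp_pos _).le]
    _ ≤ _ := by
        gcongr
        exact integral_gaussian_mul_norm_sq_extOp_le h₁ h₂ hs₁ hs₂ hd hg₁ hg₂ hε

/-- The case `P = 4` is the `L²` bound for the product; the excess power `P / 2 - 2` is absorbed by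
the trivial pointwise bound. -/
lemma exists_unitBilinearBound_two {P : ℝ} (hP : 4 ≤ P) :
    ∃ C : ℝ≥0∞, C ≠ ∞ ∧ UnitBilinearBound 2 P C := by
  set v := volume (closedCube (0 : Freq 2) 1) with hv
  have hvt : v ≠ ∞ := volume_ne_top_of_subset_closedCube subset_rfl
  have hP2 : 0 ≤ P / 2 - 2 := by linarith
  refine ⟨(v * v) ^ (P / 2 - 2) * ENNReal.ofReal (Real.exp (2 * Real.pi) * (10 * v.toReal ^ 2)),
    by finiteness, ?_⟩
  intro Ω₁ Ω₂ h₁ h₂ hs₁ hs₂ hd g₁ g₂ hg₁ hg₂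
  refine le_trans ?_ (mul_le_mul_right
    (lintegral_enorm_sq_extOp_mul_le h₁ h₂ hs₁ hs₂ hd hg₁ hg₂) _)
  rw [← lintegral_const_mul' _ _ (by finiteness)]
  refine lintegral_mono fun x => ?_
  have e : P / 2 = (P / 2 - 2) + 2 := by ring
  calc ‖extOp Ω₁ g₁ x * extOp Ω₂ g₂ x‖ₑ ^ (P / 2)
      = ‖extOp Ω₁ g₁ x * extOp Ω₂ g₂ x‖ₑ ^ (P / 2 - 2) *
          ‖extOp Ω₁ g₁ x * extOp Ω₂ g₂ x‖ₑ ^ (2 : ℝ) := by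
        rw [← ENNReal.rpow_add_of_nonneg _ _ hP2 zero_le_two, ← e]
    _ ≤ _ := by
        gcongr
        rw [enorm_mul]
        gcongr
        · exact (hg₁.enorm_extOp_le _ x).trans (measure_mono hs₁)
        · exact (hg₂.enorm_extOp_le _ x).trans (measure_mono hs₂)

/-- The linear extension estimate for the parabola, `p > 4`. -/
theorem linearExtension_two {p : ℝ≥0∞} (hp : 4 < p) : LinearExtension 2 ∞ p := by
  by_cases hpt : p = ∞
  · rw [hpt]; exact linearExtension_top 2
  have hP : 4 < p.toReal := by
    simpa using (ENNReal.toReal_lt_toReal (by finiteness) hpt).2 hp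
  obtain ⟨C, hCt, hC⟩ := exists_unitBilinearBound_two hP.le
  refine linearExtension_of_unitBilinearBound (le_trans ?_ hp.le) hpt ?_ hC hCt
  · norm_num
  · norm_num; linarith

/-! ### Necessity of `p > 4`: Fresnel integrals. -/

/-- The sine Fresnel integral is bounded below away from the origin. -/
lemma fresnel_lower_bound {R : ℝ} (hR : 1 / 2 ≤ R) :
    1 / 6 - 1 / (2 * Real.pi) ≤ ∫ u in (0 : ℝ)..R, Real.sin (2 * Real.pi * u ^ 2) := by
  have hpi := Real.pi_pos
  set S : ℝ → ℝ := fun r => ∫ u in (0 : ℝ)..r, Real.sin (2 * Real.pi * u ^ 2) with hS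
  have hcont : Continuous fun u : ℝ => Real.sin (2 * Real.pi * u ^ 2) := by fun_prop
  have hSd : ∀ r, HasDerivAt S (Real.sin (2 * Real.pi * r ^ 2)) r := fun r =>
    (hcont.integral_hasStrictDerivAt 0 r).hasDerivAt
  -- This is the boundary term in integrating by parts. Taking `1 - cos` rather than `-cos` as
  -- primitive of the sine makes the remaining integrand nonnegative, so `S - w` increases.
  set w : ℝ → ℝ := fun u => (1 - Real.cos (2 * Real.pi * u ^ 2)) / (4 * Real.pi * u) with hw
  have hgd : ∀ r, 0 < r → HasDerivAt (fun u => S u - w u)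
      ((1 - Real.cos (2 * Real.pi * r ^ 2)) / (4 * Real.pi * r ^ 2)) r := by
    intro r hr
    have h1 : HasDerivAt (fun u : ℝ => 2 * Real.pi * u ^ 2) (2 * Real.pi * (2 * r)) r := by
      simpa using (hasDerivAt_pow 2 r).const_mul (2 * Real.pi)
    have h2 : HasDerivAt (fun u : ℝ => 1 - Real.cos (2 * Real.pi * u ^ 2))
        (Real.sin (2 * Real.pi * r ^ 2) * (2 * Real.pi * (2 * r))) r := by
      simpa using (h1.cos).const_sub 1
    have h3 : HasDerivAt (fun u : ℝ => 4 * Real.pi * u) (4 * Real.pi) r := by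
      simpa using (hasDerivAt_id r).const_mul (4 * Real.pi)
    have h4 := (hSd r).sub (h2.div h3 (by positivity))
    convert! h4 using 1
    field_simp
    ring
  have hmono : MonotoneOn (fun u => S u - w u) (Set.Ici (1 / 2)) := by
    refine monotoneOn_of_deriv_nonneg (convex_Ici _) ?_ ?_ ?_
    · intro r hr
      have hr' : (1 / 2 : ℝ) ≤ r := hr
      exact (hgd r (by linarith)).continuousAt.continuousWithinAt
    · intro r hr
      rw [interior_Ici] at hr
      have hr' : (1 / 2 : ℝ) < r := hr
      exact (hgd r (by linarith)).differentiableAt.differentiableWithinAt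
    · intro r hr
      rw [interior_Ici] at hr
      have hr' : (1 / 2 : ℝ) < r := hr
      rw [(hgd r (by linarith)).deriv]
      exact div_nonneg (sub_nonneg.2 (Real.cos_le_one _)) (by positivity)
  have h1 := hmono (Set.mem_Ici.2 le_rfl) (Set.mem_Ici.2 hR) hR
  have hwR : 0 ≤ w R := by
    have : 0 < R := by linarith
    exact div_nonneg (sub_nonneg.2 (Real.cos_le_one _)) (by positivity)
  have hwhalf : w (1 / 2) = 1 / (2 * Real.pi) := by
    simp only [hw]
    rw [show 2 * Real.pi * (1 / 2) ^ 2 = Real.pi / 2 by ring, Real.cos_pi_div_two]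
    field_simp
    norm_num
  -- On `[0, 1/2]` the argument is at most `π/2`, and Jordan's inequality gives `sin (2πu²) ≥ 4u²`.
  have hShalf : 1 / 6 ≤ S (1 / 2) := by
    have hint : ∫ u in (0 : ℝ)..(1 / 2), 4 * u ^ 2 = 1 / 6 := by
      rw [intervalIntegral.integral_const_mul, integral_pow]; norm_num
    rw [← hint]
    refine intervalIntegral.integral_mono_on (by norm_num)
      (Continuous.intervalIntegrable (by fun_prop) _ _) (hcont.intervalIntegrable _ _) ?_
    intro u hu
    have hu2 : u ^ 2 ≤ 1 / 4 := by nlinarith [hu.1, hu.2]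
    have := Real.mul_le_sin (x := 2 * Real.pi * u ^ 2) (by positivity) (by nlinarith)
    refine le_trans (le_of_eq ?_) this
    field_simp
    ring
  simp only at h1
  linarith

lemma fresnel_const_pos : 0 < 1 / 6 - 1 / (2 * Real.pi) := by
  have := Real.pi_gt_three
  rw [sub_pos, div_lt_div_iff₀ (by positivity) (by norm_num)]
  linarith

/-- The substitution `u = √t v` moves the upper limit to `√t r`, which is at least `1` because `t ≥
4`. -/
lemma scaled_fresnel_lower_bound {t r : ℝ} (ht : 4 ≤ t) (hr : 1 / 2 ≤ r) :
    (1 / 6 - 1 / (2 * Real.pi)) / √t ≤ ∫ v in (0 : ℝ)..r, Real.sin (2 * Real.pi * (t * v ^ 2)) := by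
  have ht0 : 0 ≤ t := by linarith
  have hs : 2 ≤ √t := Real.le_sqrt_of_sq_le (by linarith)
  have h := intervalIntegral.integral_comp_mul_left (a := 0) (b := r)
    (fun u : ℝ => Real.sin (2 * Real.pi * u ^ 2)) (c := √t) (by positivity)
  simp only [mul_pow, Real.sq_sqrt ht0, mul_zero, smul_eq_mul] at h
  rw [h, div_eq_inv_mul]
  gcongr
  exact fresnel_lower_bound (by nlinarith)

/-- Lower bound for the extension of the constant function on `(-1,1)`. -/
lemma norm_oscillatory_integral_lower_bound {a t : ℝ} (ht : 4 ≤ t) (ha : |a| ≤ t) :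
    2 * (1 / 6 - 1 / (2 * Real.pi)) / √t ≤
      ‖∫ ξ in (-1 : ℝ)..1, Complex.exp (2 * Real.pi * Complex.I *
        ((a * ξ + t * ξ ^ 2 : ℝ) : ℂ))‖ := by
  have ht0 : 0 < t := by linarith
  -- Completing the square moves the stationary point to `-b`; as `|b| ≤ 1/2`, both ends of `[-1,1]`
  -- stay at distance at least `1/2` from it.
  set b : ℝ := a / (2 * t) with hb
  have hb1 : |b| ≤ 1 / 2 := by
    rw [hb, abs_div, abs_of_pos (by positivity : 0 < 2 * t), div_le_iff₀ (by positivity)]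
    linarith
  have hb2 := abs_le.1 hb1
  set I := ∫ ξ in (-1 : ℝ)..1, Complex.exp (2 * Real.pi * Complex.I *
        ((a * ξ + t * ξ ^ 2 : ℝ) : ℂ)) with hI
  set z := Complex.exp (2 * Real.pi * Complex.I * ((t * b ^ 2 : ℝ) : ℂ)) with hz
  have hzI : z * I = ∫ ξ in (-1 : ℝ)..1, Complex.exp (((2 * Real.pi * (t * (ξ + b) ^ 2) : ℝ) : ℂ)
      * Complex.I) := by
    rw [hI, ← intervalIntegral.integral_const_mul]
    congr 1 with ξ
    rw [hz, ← Complex.exp_add]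
    congr 1
    have : a = 2 * t * b := by rw [hb]; field_simp
    rw [this]
    push_cast
    ring
  have him : (z * I).im = ∫ ξ in (-1 : ℝ)..1, Real.sin (2 * Real.pi * (t * (ξ + b) ^ 2)) := by
    have hc : Continuous fun ξ : ℝ => Complex.exp (((2 * Real.pi * (t * (ξ + b) ^ 2) : ℝ) : ℂ)
      * Complex.I) := by fun_prop
    have := Complex.imCLM.intervalIntegral_comp_comm (hc.intervalIntegrable (-1) 1 (μ := volume))
    rw [hzI, ← Complex.imCLM_apply, ← this]
    congr 1 with ξ
    rw [Complex.imCLM_apply, Complex.exp_ofReal_mul_I_im]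
  have hcs : Continuous fun v : ℝ => Real.sin (2 * Real.pi * (t * v ^ 2)) := by fun_prop
  -- Splitting at the stationary point, evenness gives two Fresnel integrals from `0`, both
  -- positive, so nothing cancels.
  have hsplit : (z * I).im = (∫ v in (0 : ℝ)..(1 + b), Real.sin (2 * Real.pi * (t * v ^ 2))) +
      ∫ v in (0 : ℝ)..(1 - b), Real.sin (2 * Real.pi * (t * v ^ 2)) := by
    have h1 := intervalIntegral.integral_comp_add_right (a := -1) (b := 1)
      (fun v : ℝ => Real.sin (2 * Real.pi * (t * v ^ 2))) b
    have h2 := intervalIntegral.integral_comp_neg (a := 0) (b := 1 - b)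
      (fun v : ℝ => Real.sin (2 * Real.pi * (t * v ^ 2)))
    simp only [neg_sq, neg_zero] at h2
    rw [him, h1, h2, add_comm (∫ v in (0 : ℝ)..(1 + b), _), show -(1 - b) = -1 + b by ring]
    exact (intervalIntegral.integral_add_adjacent_intervals (hcs.intervalIntegrable _ _)
      (hcs.intervalIntegrable _ _)).symm
  have hn : ‖z * I‖ = ‖I‖ := by
    rw [norm_mul, hz, norm_cexp_two_pi_I_mul, one_mul]
  rw [← hn]
  refine le_trans ?_ ((le_abs_self _).trans (Complex.abs_im_le_norm _))
  rw [hsplit]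
  have i1 := scaled_fresnel_lower_bound ht (r := 1 + b) (by linarith [hb2.1])
  have i2 := scaled_fresnel_lower_bound ht (r := 1 - b) (by linarith [hb2.2])
  rw [mul_div_assoc]
  linarith

lemma measurePreserving_coord_freq_two :
    MeasurePreserving (fun ξ : Freq 2 => ξ 0) volume volume :=
  (volume_preserving_funUnique (Fin 1) ℝ).comp (PiLp.volume_preserving_ofLp (Fin 1))

lemma measurableEmbedding_coord_freq_two : MeasurableEmbedding (fun ξ : Freq 2 => ξ 0) :=
  (MeasurableEquiv.funUnique (Fin 1) ℝ).measurableEmbedding.comp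
    (MeasurableEquiv.toLp 2 (Fin 1 → ℝ)).symm.measurableEmbedding

lemma extOp_one_two (x : Phys 2) :
    extOp (openUnitCube 2) (fun _ => 1) x = ∫ ξ in (-1 : ℝ)..1,
      Complex.exp (2 * Real.pi * Complex.I * ((x.1 0 * ξ + x.2 * ξ ^ 2 : ℝ) : ℂ)) := by
  have hset : openUnitCube 2 = (fun ξ : Freq 2 => ξ 0) ⁻¹' Set.Ioo (-1) 1 := by
    ext ξ
    constructor
    · intro h; exact abs_lt.1 (h 0)
    · intro h j
      rw [Subsingleton.elim (α := Fin 1) j 0]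
      exact abs_lt.2 h
  rw [intervalIntegral.integral_of_le (by norm_num), integral_Ioc_eq_integral_Ioo,
    ← measurePreserving_coord_freq_two.setIntegral_preimage_emb
      measurableEmbedding_coord_freq_two, ← hset]
  unfold extOp
  congr 1 with ξ
  rw [one_mul]
  congr 3
  have hin : inner ℝ x.1 ξ = x.1 0 * ξ 0 := by
    simp [PiLp.inner_apply, mul_comm]
  rw [norm_freq_two, sq_abs, hin]

lemma volume_closedBall_freq_two (t : ℝ) :
    volume (Metric.closedBall (0 : Freq 2) t) = ENNReal.ofReal (2 * t) := by
  have hset : Metric.closedBall (0 : Freq 2) t = (fun ξ : Freq 2 => ξ 0) ⁻¹' Set.Icc (-t) t := by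
    ext ξ
    rw [mem_closedBall_zero_iff, norm_freq_two, abs_le]
    rfl
  rw [hset, measurePreserving_coord_freq_two.measure_preimage measurableSet_Icc.nullMeasurableSet,
    Real.volume_Icc]
  congr 1
  ring

lemma lintegral_Ioi_inv_eq_top (a : ℝ) : ∫⁻ t in Set.Ioi a, ENNReal.ofReal |t⁻¹| = ∞ := by
  by_contra h
  refine not_integrableOn_Ioi_inv (a := a) ⟨by fun_prop, ?_⟩
  rw [hasFiniteIntegral_iff_norm]
  exact Ne.lt_top h

/-- The extension of the constant function on `(-1,1)` is not in `L^p` for `p ≤ 4`. -/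
lemma lintegral_extOp_one_eq_top {P : ℝ} (hP0 : 0 ≤ P) (hP : P ≤ 4) :
    ∫⁻ x : Phys 2, ‖extOp (openUnitCube 2) (fun _ => 1) x‖ₑ ^ P = ∞ := by
  set c : ℝ := 2 * (1 / 6 - 1 / (2 * Real.pi)) with hc
  have hc0 : 0 < c := by have := fresnel_const_pos; positivity
  have hu : UnitBounded (fun _ : Freq 2 => (1 : ℂ)) := ⟨measurable_const, fun _ => by simp⟩
  have hm := measurable_enorm_extOp_rpow hu
    (volume_ne_top_of_subset_closedCube (openUnitCube_subset 2)) P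
  rw [eq_top_iff, Measure.volume_eq_prod, lintegral_prod_symm' _ hm]
  calc ∞ = ENNReal.ofReal (c ^ P) * ∫⁻ t in Set.Ioi (4 : ℝ), ENNReal.ofReal |t⁻¹| := by
        rw [lintegral_Ioi_inv_eq_top, ENNReal.mul_top]
        simpa using Real.rpow_pos_of_pos hc0 P
    _ = ∫⁻ t in Set.Ioi (4 : ℝ), ENNReal.ofReal (c ^ P) * ENNReal.ofReal |t⁻¹| :=
        (lintegral_const_mul' _ _ ENNReal.ofReal_ne_top).symm
    _ ≤ ∫⁻ t in Set.Ioi (4 : ℝ), ∫⁻ y : Freq 2,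
          ‖extOp (openUnitCube 2) (fun _ => 1) (y, t)‖ₑ ^ P := by
        refine setLIntegral_mono' measurableSet_Ioi fun t ht => ?_
        have ht4 : 4 < t := ht
        have ht0 : 0 < t := by linarith
        have hs1 : 1 ≤ √t := Real.one_le_sqrt.2 (by linarith)
        -- At time `t` the lower bound `c/√t` holds on an interval of length `2t`. As `P ≤ 4`, the
        -- slice contributes at least `c^P / t`, whose integral in `t` diverges logarithmically.
        calc ENNReal.ofReal (c ^ P) * ENNReal.ofReal |t⁻¹|
            ≤ ENNReal.ofReal (c / √t) ^ P * volume (Metric.closedBall (0 : Freq 2) t) := by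
              rw [volume_closedBall_freq_two, ENNReal.ofReal_rpow_of_pos (by positivity),
                ← ENNReal.ofReal_mul (by positivity), ← ENNReal.ofReal_mul (by positivity)]
              refine ENNReal.ofReal_le_ofReal ?_
              rw [Real.div_rpow hc0.le (by positivity), abs_of_pos (by positivity)]
              have h4 : √t ^ P ≤ t ^ 2 := by
                calc √t ^ P ≤ √t ^ (4 : ℝ) := Real.rpow_le_rpow_of_exponent_le hs1 hP
                  _ = (√t ^ 2) ^ 2 := by
                      rw [← pow_mul]; exact_mod_cast Real.rpow_natCast (√t) 4
                  _ = t ^ 2 := by rw [Real.sq_sqrt ht0.le]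
              have hcP : 0 < c ^ P := Real.rpow_pos_of_pos hc0 P
              calc c ^ P * t⁻¹ = c ^ P / t ^ 2 * t := by field_simp
                _ ≤ c ^ P / √t ^ P * (2 * t) := by
                    have : 0 < √t ^ P := Real.rpow_pos_of_pos (by positivity) P
                    gcongr
                    linarith
          _ = ∫⁻ _y in Metric.closedBall (0 : Freq 2) t, ENNReal.ofReal (c / √t) ^ P := by
              rw [setLIntegral_const]
          _ ≤ ∫⁻ y in Metric.closedBall (0 : Freq 2) t,
                ‖extOp (openUnitCube 2) (fun _ => 1) (y, t)‖ₑ ^ P := by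
              refine setLIntegral_mono' Metric.isClosed_closedBall.measurableSet fun y hy => ?_
              have hy' : |y 0| ≤ t := by
                rwa [mem_closedBall_zero_iff, norm_freq_two] at hy
              have := norm_oscillatory_integral_lower_bound ht4.le hy'
              gcongr
              rw [extOp_one_two, ← ofReal_norm]
              exact ENNReal.ofReal_le_ofReal this
          _ ≤ _ := setLIntegral_le_lintegral _ _
    _ ≤ _ := setLIntegral_le_lintegral _ _

/-- The linear extension estimate for the parabola fails for `p ≤ 4`. -/
theorem four_lt_of_linearExtension_two {p : ℝ≥0∞} (hp1 : 1 ≤ p) (h : LinearExtension 2 ∞ p) :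
    4 < p := by
  by_contra hp
  have hp4 : p ≤ 4 := not_lt.1 hp
  have hpt : p ≠ ∞ := ne_top_of_le_ne_top (by finiteness) hp4
  have hp0 : p ≠ 0 := (zero_lt_one.trans_le hp1).ne'
  have hP : p.toReal ≤ 4 := by
    simpa using ENNReal.toReal_mono (b := 4) (by finiteness) hp4
  have hpp : 0 < p.toReal := ENNReal.toReal_pos hp0 hpt
  obtain ⟨C, hC⟩ := h
  have hmem : MemLp (fun _ : Freq 2 => (1 : ℂ)) ∞ (volume.restrict (openUnitCube 2)) :=
    memLp_top_const 1
  have key := hC _ hmem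
  rw [eLpNorm_eq_lintegral_rpow_enorm_toReal hp0 hpt,
    lintegral_extOp_one_eq_top hpp.le hP, ENNReal.top_rpow_of_pos (by positivity),
    top_le_iff] at key
  exact ENNReal.mul_ne_top ENNReal.coe_ne_top hmem.2.ne key

end Restriction

theorem theorem3p8 :
    (∀ (n : ℕ) (p : ℝ≥0∞),
      ((3 ≤ n ∧ ENNReal.ofReal (2 * (n : ℝ) / ((n : ℝ) - 1)) < p ∧ p ≤ 4) ∨ (n = 2 ∧ 4 < p)) →
      Restriction.BR n ∞ p (1 / 2) < ∞ →
      Restriction.LinearExtension n ∞ p) ∧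
    (∀ p : ℝ≥0∞, 1 ≤ p → (Restriction.LinearExtension 2 ∞ p ↔ 4 < p)) := by
  refine ⟨?_, fun p hp => ⟨Restriction.four_lt_of_linearExtension_two hp,
    Restriction.linearExtension_two⟩⟩
  rintro n p (⟨hn, hp, hp4⟩ | ⟨rfl, hp⟩) hBR
  · exact Restriction.linearExtension_of_BR_lt_top (by omega) hp
      (ne_top_of_le_ne_top (by finiteness) hp4) hBR
  · exact Restriction.linearExtension_two hp
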